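/- A $k$-uniform hypergraph $\mathcal H$ consists of a finite vertex set $V(\mathcal H)$ and a set of $k$-element subsets of $V(\mathcal H)$, called edges; $v(\mathcal H)$ and $e(\mathcal H)$ denote its numbers of vertices and edges. For $W\subseteq V(\mathcal H)$ let $\mathcal H[W]$ be the induced subhypergraph, whose edges are the edges of $\mathcal H$ contained in $W$. Let $\Delta_2(\mathcal H)$ be the maximum, over all two-element sets $S\subseteq V(\mathcal H)$, of the number of edges of $\mathcal H$ containing $S$. For $p\in(0,1]$ let $V_p(\mathcal H)$ be the random subset of $V(\mathcal H)$ that contains each vertex independently with probability $p$, and let $\mathcal H_p=\mathcal H[V_p(\mathcal H)]$. For real $D$ and $x\ge 0$ let $\mathfrak X(\mathcal H,D,x)$ be the property that there is $W\subseteq V(\mathcal H)$ with $|W|\le D\max\{\sqrt x,1\}$ and $e(\mathcal H[W])\ge x$. **Theorem.** Let $k\ge 3$ be an integer, and let $a>0$ and $D\ge 1$ be real. There are an integer $n_0>0$ and reals $b,B>0$, depending only on $k,a,D$, such that the following holds for all integers $n\ge n_0$, all $k$-uniform hypergraphs $\mathcal H$ with $v(\mathcal H)\le Dn$, $e(\mathcal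 H)\ge an^2$ and $\Delta_2(\mathcal H)\le D$, all $p\in(0,1]$ and all $\varepsilon>0$. Put $X=e(\mathcal H_p)$ and $\mu=\mathbb E X$. Then $$\mathbb P\bigl(X\ge(1+\varepsilon)\mu\bigr)\le\exp\Bigl(-b\min\{\varepsilon^3,\varepsilon^{1/2}\}\min\bigl\{\mu,\ \sqrt{\mu}\,\log(e/p)\bigr\}\Bigr),$$ where $e$ in $\log(e/p)$ is Euler's number. If, in addition, $\mathfrak X(\mathcal H,D,(1+\varepsilon)\mu)$ and $(1+\varepsilon)\mu\ge 1$ hold, then $$\mathbb P\bigl(X\ge(1+\varepsilon)\mu\bigr)\ge\exp\Bigl(-B\max\{1,\varepsilon^2\}\min\bigl\{\mu,\ \sqrt{\mu}\,\log(1/p)\bigr\}\Bigr).$$ -/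

import Mathlib

open MeasureTheory ProbabilityTheory

namespace Hypergraph

variable {V : Type*}

/-- The subhypergraph `H[S]` induced by a set `S` of vertices: its edges are the edges of `H` that
are contained in `S`. -/
def induced (H : Hypergraph V) (S : Set V) : Hypergraph V where
  vertexSet := H.vertexSet ∩ S
  edgeSet := {f | f ∈ H.edgeSet ∧ f ⊆ S}
  subset_vertexSet_of_mem_edgeSet' := fun _ hf =>
    Set.subset_inter (H.subset_vertexSet_of_mem_edgeSet' hf.1) hf.2

/-- The number of vertices `v(H)`. -/
noncomputable def numVertices (H : Hypergraph V) : ℕ := H.vertexSet.ncard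

/-- The number of edges `e(H)`. -/
noncomputable def numEdges (H : Hypergraph V) : ℕ := H.edgeSet.ncard

/-- `H` is `k`-uniform: every edge has exactly `k` vertices. -/
def IsUniform (H : Hypergraph V) (k : ℕ) : Prop := ∀ f ∈ H.edgeSet, f.ncard = k

/-- `Δ_j(H)`: the maximum, over all sets `S` of `j` vertices, of the number of edges containing
`S` (and `0` if there is no such `S`). On a finite vertex type the set below is finite, so this is
a genuine maximum. -/
noncomputable def maxDegree (H : Hypergraph V) (j : ℕ) : ℕ :=
  sSup {d : ℕ | ∃ S : Set V, S ⊆ H.vertexSet ∧ S.ncard = j ∧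
    d = {f : Set V | f ∈ H.edgeSet ∧ S ⊆ f}.ncard}

/-- The clustering property `𝔛(H, D, x)`: some set `W` of at most `D max{√x, 1}` vertices induces
at least `x` edges. -/
def ClusterProperty (H : Hypergraph V) (D x : ℝ) : Prop :=
  ∃ W : Set V, W ⊆ H.vertexSet ∧ (W.ncard : ℝ) ≤ D * max (Real.sqrt x) 1 ∧
    x ≤ ((H.induced W).numEdges : ℝ)

/-- The law of the random vertex subset `V_p(H)`, which contains each vertex of `H` independently
with probability `p`. -/
noncomputable def randomVertexSet (H : Hypergraph V) (p : unitInterval) : Measure (Set V) :=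
  setBernoulli H.vertexSet p

/-- The random variable `X = e(H_p)`, where `H_p = H[V_p(H)]`, as a function of the outcome `S` of
`V_p(H)`. -/
noncomputable def inducedEdgeCount (H : Hypergraph V) (S : Set V) : ℝ :=
  ((H.induced S).numEdges : ℝ)

/-- The expectation `μ = 𝔼 X` of `X = e(H_p)`. -/
noncomputable def meanEdgeCount (H : Hypergraph V) (p : unitInterval) : ℝ :=
  ∫ S, H.inducedEdgeCount S ∂(H.randomVertexSet p)

/-- The upper tail probability `ℙ(X ≥ x)` of `X = e(H_p)`. -/
noncomputable def upperTail (H : Hypergraph V) (p : unitInterval) (x : ℝ) : ℝ :=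
  (H.randomVertexSet p).real {S : Set V | x ≤ H.inducedEdgeCount S}

end Hypergraph

/-! Write t = εμ and d for the codegree bound. For the upper bound, count ordered sequences of
pairwise disjoint edges. Disjointness makes the first moment of sequences of length R at most μ^R.
If the random hypergraph contains a subhypergraph with at least μ + t/2 edges in which every edge
meets at most C edges, a greedy choice with R about t/C gives at least (μ + t/4)^R sequences, and
Markov's inequality makes this unlikely (`pr_exists_subset_le`).

Such a subhypergraph arises by deleting few edges. With bounded codegrees, a vertex of large degree
is the centre of a large star whose edges share only the centre. If there are no r + 1 disjoint
stars of size s and no star of size (r + 1)s, a set of at most rsk vertices meets every star of size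
s, and deleting the edges that meet it leaves degrees at most skd (`exists_subset_degree_le`). One
takes s of order max(1, √((1 + ε)μ)/log(e/p)) and, unless r = 0, (r + 1)s of order √t, so that at
most t/2 edges are deleted. For small p the expected number of stars of size j ≥ s is at most
p^(j/8) (`star_bound`), so both star events have probability exp(-Ω(√t log(1/p))). For p bounded
below, all degrees are O(n) = O(√μ) and no deletion is needed. A final use of Markov's inequality,
P(X ≥ (1 + ε)μ) ≤ 1/(1 + ε), absorbs the factor 3 of the union bound; this turns ε² into ε³.

For the lower bound there are two strategies. If √μ log(1/p) ≤ μ, force the clustered set W into the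
random set, at cost p^|W|. Otherwise split the edges into m = ⌈(1 + ε)μ⌉ equal blocks: the second
moment method bounds below the chance that a block is hit, and Harris' inequality multiplies these
chances (`pow_le_pr_of_le_card`). -/

namespace UpperTail

open Finset

variable {V : Type*}

/-- The total weight of a family `A` of vertex sets. -/
noncomputable def pr [Fintype V] (w : Finset V → ℝ) (A : Set (Finset V)) : ℝ := ∑ S, A.indicator w S

/-- The properties of the point masses of the random subset of `U` containing each element
independently with probability `p`. -/
structure IsBernoulliWeight [Fintype V] [DecidableEq V] (w : Finset V → ℝ) (U : Finset V) (p : ℝ) : Prop where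
  nonneg : ∀ S, 0 ≤ w S
  pr_superset : ∀ A ⊆ U, pr w {S | A ⊆ S} = p ^ #A
  supermodular : ∀ S T, w S * w T ≤ w (S ⊓ T) * w (S ⊔ T)

variable [DecidableEq V]

/-- The members of `F` contained in `S`. -/
def within (F : Finset (Finset V)) (S : Finset V) : Finset (Finset V) := {e ∈ F | e ⊆ S}

/-- The number of sequences of `r` members of `J`, each disjoint from `A` and from the earlier
ones. -/
def disjointSeqCount (J : Finset (Finset V)) : ℕ → Finset V → ℕ
  | 0, _ => 1
  | r + 1, A => ∑ e ∈ J with Disjoint e A, disjointSeqCount J r (A ∪ e)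

lemma mem_within {F : Finset (Finset V)} {S e : Finset V} :
    e ∈ within F S ↔ e ∈ F ∧ e ⊆ S := by simp [within]

/-! ### Moment and correlation inequalities for the random set. -/

section Weight

variable [Fintype V] {w : Finset V → ℝ} {U : Finset V} {p : ℝ}

omit [DecidableEq V] in
lemma pr_eq_sum_mul (w : Finset V → ℝ) (A : Set (Finset V)) [DecidablePred (· ∈ A)] :
    pr w A = ∑ S, w S * (if S ∈ A then 1 else 0) := by
  simp only [pr, Set.indicator_apply]
  refine sum_congr rfl fun S _ => ?_
  split_ifs <;> simp

namespace IsBernoulliWeight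

lemma sum_eq_one (hw : IsBernoulliWeight w U p) : ∑ S, w S = 1 := by
  have := hw.pr_superset ∅ (by simp)
  simpa [pr] using this

lemma pr_mono (hw : IsBernoulliWeight w U p) {A B : Set (Finset V)} (h : A ⊆ B) :
    pr w A ≤ pr w B :=
  sum_le_sum fun S _ => Set.indicator_le_indicator_of_subset h hw.nonneg S

lemma pr_union_le (hw : IsBernoulliWeight w U p) (A B : Set (Finset V)) :
    pr w (A ∪ B) ≤ pr w A + pr w B := by
  classical
  simp only [pr, ← sum_add_distrib, Set.indicator_apply, Set.mem_union]
  refine sum_le_sum fun S _ => ?_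
  have := hw.nonneg S
  split_ifs <;> first | linarith | tauto

lemma pr_nonneg (hw : IsBernoulliWeight w U p) (A : Set (Finset V)) : 0 ≤ pr w A :=
  sum_nonneg fun S _ => Set.indicator_nonneg (fun S _ => hw.nonneg S) S

lemma pr_univ (hw : IsBernoulliWeight w U p) : pr w Set.univ = 1 := by
  simpa [pr] using hw.sum_eq_one

/-- Markov's inequality. -/
lemma mul_pr_le (hw : IsBernoulliWeight w U p) {f : Finset V → ℝ} (hf : ∀ S, 0 ≤ f S) (y : ℝ) :
    y * pr w {S | y ≤ f S} ≤ ∑ S, w S * f S := by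
  classical
  rw [pr, mul_sum]
  refine sum_le_sum fun S _ => ?_
  have h1 := hw.nonneg S
  have h2 := hf S
  simp only [Set.indicator_apply, Set.mem_ofPred_eq]
  split_ifs with h
  · rw [mul_comm]; exact mul_le_mul_of_nonneg_left h h1
  · rw [mul_zero]; positivity

/-- Harris' inequality. -/
lemma pr_mul_pr_le (hw : IsBernoulliWeight w U p) {A B : Set (Finset V)}
    (hA : IsUpperSet A) (hB : IsUpperSet B) : pr w A * pr w B ≤ pr w (A ∩ B) := by
  classical
  have key (C : Set (Finset V)) (hC : IsUpperSet C) :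
      Monotone (fun S => if S ∈ C then (1 : ℝ) else 0) := by
    intro S T hST
    dsimp only
    split_ifs with h1 h2
    · exact le_rfl
    · exact absurd (hC hST h1) h2
    · norm_num
    · exact le_rfl
  have h := fkg (μ := w) (f := fun S => if S ∈ A then (1 : ℝ) else 0)
    (g := fun S => if S ∈ B then (1 : ℝ) else 0) hw.nonneg
    (fun S => by dsimp only; split_ifs <;> simp) (fun S => by dsimp only; split_ifs <;> simp)
    (key A hA) (key B hB) hw.supermodular
  rw [hw.sum_eq_one, one_mul] at h
  rw [pr_eq_sum_mul, pr_eq_sum_mul, pr_eq_sum_mul]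
  refine h.trans_eq (sum_congr rfl fun S _ => ?_)
  by_cases h1 : S ∈ A <;> by_cases h2 : S ∈ B <;> simp [h1, h2]

lemma sum_mul_card_within (hw : IsBernoulliWeight w U p) {F : Finset (Finset V)}
    (hF : ∀ e ∈ F, e ⊆ U) :
    ∑ S, w S * (#(within F S) : ℝ) = ∑ e ∈ F, p ^ #e := by
  have h (S : Finset V) : w S * (#(within F S) : ℝ) = ∑ e ∈ F, w S * (if e ⊆ S then 1 else 0) := by
    rw [within, card_filter, ← mul_sum]; push_cast; rfl
  simp_rw [h]
  rw [sum_comm]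
  refine sum_congr rfl fun e he => ?_
  rw [← hw.pr_superset e (hF e he), pr_eq_sum_mul]
  rfl

/-- For members disjoint from A and from each other, the probability that A and all of them lie in
the random set is a product. Carrying the already chosen set A makes the induction work: a new
member e moves into it. -/
lemma sum_mul_disjointSeqCount_le (hw : IsBernoulliWeight w U p) (hp : 0 ≤ p)
    {F : Finset (Finset V)} (hF : ∀ e ∈ F, e ⊆ U) (r : ℕ) (A : Finset V) (hA : A ⊆ U) :
    ∑ S, w S * (if A ⊆ S then (disjointSeqCount (within F S) r A : ℝ) else 0) ≤
      p ^ #A * (∑ e ∈ F, p ^ #e) ^ r := by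
  induction r generalizing A with
  | zero =>
    simp only [disjointSeqCount, Nat.cast_one, pow_zero, mul_one]
    rw [← hw.pr_superset A hA, pr_eq_sum_mul]
    rfl
  | succ r ih =>
    have h (S : Finset V) :
        w S * (if A ⊆ S then (disjointSeqCount (within F S) (r + 1) A : ℝ) else 0) =
          ∑ e ∈ F with Disjoint e A,
            w S * (if A ∪ e ⊆ S then (disjointSeqCount (within F S) r (A ∪ e) : ℝ) else 0) := by
      rw [← mul_sum]
      congr 1
      split_ifs with hAS
      · rw [disjointSeqCount, within, filter_filter, Nat.cast_sum, sum_filter, sum_filter]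
        refine sum_congr rfl fun e _ => ?_
        by_cases h1 : e ⊆ S <;> by_cases h2 : Disjoint e A <;>
          simp [h1, h2, union_subset_iff, hAS]
      · refine (sum_eq_zero fun e _ => if_neg fun h => hAS ?_).symm
        exact subset_union_left.trans h
    simp_rw [h]
    rw [sum_comm]
    calc ∑ e ∈ F with Disjoint e A, ∑ S,
          w S * (if A ∪ e ⊆ S then (disjointSeqCount (within F S) r (A ∪ e) : ℝ) else 0)
        ≤ ∑ e ∈ F with Disjoint e A, p ^ #(A ∪ e) * (∑ e ∈ F, p ^ #e) ^ r :=
          sum_le_sum fun e he =>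
            ih (A ∪ e) (union_subset hA (hF e (mem_filter.1 he).1))
      _ = ∑ e ∈ F with Disjoint e A, p ^ #A * (p ^ #e * (∑ e ∈ F, p ^ #e) ^ r) := by
          refine sum_congr rfl fun e he => ?_
          rw [card_union_of_disjoint (mem_filter.1 he).2.symm, pow_add, mul_assoc]
      _ ≤ ∑ e ∈ F, p ^ #A * (p ^ #e * (∑ e ∈ F, p ^ #e) ^ r) :=
          sum_le_sum_of_subset_of_nonneg (filter_subset _ _) fun _ _ _ => by positivity
      _ = p ^ #A * (∑ e ∈ F, p ^ #e) ^ (r + 1) := by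
          rw [← mul_sum, ← sum_mul, pow_succ']

/-- The first moment bound for sequences of disjoint members. -/
lemma mul_pr_disjointSeqCount_le (hw : IsBernoulliWeight w U p) (hp : 0 ≤ p)
    {F : Finset (Finset V)} (hF : ∀ e ∈ F, e ⊆ U) (r : ℕ) (y : ℝ) :
    y * pr w {S | y ≤ (disjointSeqCount (within F S) r ∅ : ℝ)} ≤ (∑ e ∈ F, p ^ #e) ^ r := by
  refine (hw.mul_pr_le (fun S => Nat.cast_nonneg _) y).trans ?_
  simpa using hw.sum_mul_disjointSeqCount_le hp hF r ∅ (empty_subset _)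

end IsBernoulliWeight

end Weight

/-! ### Disjoint sequences, stars and the deletion argument. -/

section Combinatorics

lemma disjointSeqCount_mono {J K : Finset (Finset V)} (h : J ⊆ K) (r : ℕ) (A : Finset V) :
    disjointSeqCount J r A ≤ disjointSeqCount K r A := by
  induction r generalizing A with
  | zero => simp [disjointSeqCount]
  | succ r ih =>
    exact (sum_le_sum fun e _ => ih (A ∪ e)).trans
      (sum_le_sum_of_subset (filter_subset_filter _ h))

/-- Greedy choice: every chosen member blocks at most C others, so at each of the r steps at least y
members are still available. -/
lemma pow_le_disjointSeqCount {J : Finset (Finset V)} {C : ℕ}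
    (hC : ∀ e ∈ J, #{f ∈ J | ¬ Disjoint f e} ≤ C) {y : ℝ} (hy : 0 ≤ y) (r : ℕ) (A : Finset V)
    (h : ∀ i < r, y + #{f ∈ J | ¬ Disjoint f A} + i * C ≤ #J) :
    y ^ r ≤ disjointSeqCount J r A := by
  induction r generalizing A with
  | zero => simp [disjointSeqCount]
  | succ r ih =>
    have hstep : ∀ e ∈ J, y ^ r ≤ disjointSeqCount J r (A ∪ e) := fun e he => by
      refine ih _ fun i hi => ?_
      have h1 := h (i + 1) (by omega)
      have h2 : #{f ∈ J | ¬ Disjoint f (A ∪ e)} ≤ #{f ∈ J | ¬ Disjoint f A} + C := by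
        refine le_trans ?_ (Nat.add_le_add_left (hC e he) _)
        refine le_trans (card_le_card fun f hf => ?_) (card_union_le _ _)
        simp only [mem_filter, mem_union, disjoint_union_right] at hf ⊢
        tauto
      have h3 : (#{f ∈ J | ¬ Disjoint f (A ∪ e)} : ℝ) ≤ #{f ∈ J | ¬ Disjoint f A} + C := by
        exact_mod_cast h2
      push_cast at h1
      linarith
    rw [disjointSeqCount, Nat.cast_sum]
    have h0 := h 0 (by omega)
    have hcard : (#{f ∈ J | Disjoint f A} : ℝ) + #{f ∈ J | ¬ Disjoint f A} = #J := by
      exact_mod_cast card_filter_add_card_filter_not (s := J) (fun f => Disjoint f A)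
    calc y ^ (r + 1) = y * y ^ r := pow_succ' y r
      _ ≤ #{f ∈ J | Disjoint f A} * y ^ r := by
          gcongr
          push_cast at h0
          linarith
      _ = ∑ e ∈ J with Disjoint e A, y ^ r := by simp
      _ ≤ _ := sum_le_sum fun e he => hstep e (mem_filter.1 he).1

/-- Without `r` pairwise disjoint members, a small set meets every member. -/
lemma exists_cover_of_disjointSeqCount_eq_zero {J : Finset (Finset V)} {m : ℕ}
    (hm : ∀ e ∈ J, #e ≤ m) (r : ℕ) (A : Finset V) (h : disjointSeqCount J (r + 1) A = 0) :
    ∃ B : Finset V, #B ≤ #A + r * m ∧ ∀ e ∈ J, ¬ Disjoint e B := by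
  induction r generalizing A with
  | zero =>
    refine ⟨A, by simp, fun e he hd => ?_⟩
    rw [disjointSeqCount, sum_eq_zero_iff] at h
    simpa [disjointSeqCount] using h e (mem_filter.2 ⟨he, hd⟩)
  | succ r ih =>
    by_cases hA : ∀ e ∈ J, ¬ Disjoint e A
    · exact ⟨A, by omega, hA⟩
    · push Not at hA
      obtain ⟨e, he, hd⟩ := hA
      rw [disjointSeqCount, sum_eq_zero_iff] at h
      obtain ⟨B, hB, hB'⟩ := ih (A ∪ e) (h e (mem_filter.2 ⟨he, hd⟩))
      refine ⟨B, hB.trans ?_, hB'⟩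
      have h1 := card_union_le A e
      have h2 := hm e he
      rw [Nat.succ_mul]
      omega

/-- The vertex sets of stars in `E`: families of `s` edges through a vertex `v ∈ U` that pairwise
share no other vertex. -/
def stars (E : Finset (Finset V)) (U : Finset V) (s : ℕ) : Finset (Finset V) :=
  U.biUnion fun v => ({F ∈ powersetCard s {e ∈ E | v ∈ e} |
    ∀ e ∈ F, ∀ f ∈ F, e ≠ f → e ∩ f ⊆ {v}}).image fun F => F.biUnion id

lemma mem_stars {E : Finset (Finset V)} {U : Finset V} {s : ℕ} {T : Finset V} :
    T ∈ stars E U s ↔ ∃ v ∈ U, ∃ F : Finset (Finset V), F ⊆ E ∧ (∀ e ∈ F, v ∈ e) ∧ #F = s ∧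
      (∀ e ∈ F, ∀ f ∈ F, e ≠ f → e ∩ f ⊆ {v}) ∧ F.biUnion id = T := by
  simp only [stars, mem_biUnion, mem_image, mem_filter, mem_powersetCard, subset_iff]
  constructor
  · rintro ⟨v, hv, F, ⟨⟨h1, h2⟩, h3⟩, h4⟩
    exact ⟨v, hv, F, fun e he => (h1 he).1, fun e he => (h1 he).2, h2, h3, h4⟩
  · rintro ⟨v, hv, F, h1, h2, h3, h4, h5⟩
    exact ⟨v, hv, F, ⟨⟨fun e he => ⟨h1 he, h2 e he⟩, h3⟩, h4⟩, h5⟩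

lemma stars_mono {E E' : Finset (Finset V)} (h : E ⊆ E') (U : Finset V) (s : ℕ) :
    stars E U s ⊆ stars E' U s := by
  intro T hT
  rw [mem_stars] at hT ⊢
  obtain ⟨v, hv, F, h1, h2⟩ := hT
  exact ⟨v, hv, F, h1.trans h, h2⟩

lemma stars_within (E : Finset (Finset V)) (U : Finset V) (s : ℕ) (S : Finset V) :
    stars (within E S) U s ⊆ within (stars E U s) S := by
  intro T hT
  rw [mem_within]
  refine ⟨stars_mono (filter_subset _ _) U s hT, ?_⟩
  obtain ⟨v, hv, F, h1, h2, h3, h4, rfl⟩ := mem_stars.1 hT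
  exact biUnion_subset.2 fun e he => (mem_within.1 (h1 he)).2

lemma subset_of_mem_stars {E : Finset (Finset V)} {U T : Finset V} {s : ℕ}
    (hE : ∀ e ∈ E, e ⊆ U) (hT : T ∈ stars E U s) : T ⊆ U := by
  obtain ⟨v, hv, F, h1, h2, h3, h4, rfl⟩ := mem_stars.1 hT
  exact biUnion_subset.2 fun e he => hE e (h1 he)

lemma card_stars_le {E : Finset (Finset V)} {U : Finset V} {s Δ : ℕ}
    (hΔ : ∀ v, #{e ∈ E | v ∈ e} ≤ Δ) : #(stars E U s) ≤ #U * Δ.choose s := by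
  refine card_biUnion_le_card_mul _ _ _ fun v _ => ?_
  refine card_image_le.trans ((card_filter_le _ _).trans ?_)
  rw [card_powersetCard]
  exact Nat.choose_le_choose s (hΔ v)

lemma card_le_of_mem_stars {E : Finset (Finset V)} {U T : Finset V} {s k : ℕ}
    (hk : ∀ e ∈ E, #e = k) (hT : T ∈ stars E U s) : #T ≤ s * k := by
  obtain ⟨v, hv, F, h1, h2, rfl, h4, rfl⟩ := mem_stars.1 hT
  exact card_biUnion_le_card_mul _ _ _ fun e he => (hk e (h1 he)).le

/-- Without the centre, the edges of a star are pairwise disjoint sets of k - 1 vertices. This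
yields the factor p^((k-1)s) in the first moment of stars. -/
lemma le_card_of_mem_stars {E : Finset (Finset V)} {U T : Finset V} {s k : ℕ}
    (hk : ∀ e ∈ E, #e = k) (hT : T ∈ stars E U s) : (k - 1) * s ≤ #T := by
  obtain ⟨v, hv, F, h1, h2, rfl, h4, rfl⟩ := mem_stars.1 hT
  have hsub : F.biUnion (fun e => e.erase v) ⊆ F.biUnion id :=
    biUnion_mono fun e _ => erase_subset _ _
  refine le_trans (le_of_eq ?_) (card_le_card hsub)
  rw [card_biUnion]
  · rw [sum_congr rfl (fun e he => by rw [card_erase_of_mem (h2 e he), hk e (h1 he)]),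
      sum_const, smul_eq_mul, mul_comm]
  · intro e he f hf hef
    refine Finset.disjoint_left.2 fun u hu hu' => ?_
    rw [mem_erase] at hu hu'
    exact hu.1 (mem_singleton.1 (h4 e he f hf hef (mem_inter.2 ⟨hu.2, hu'.2⟩)))

/-- In a hypergraph with bounded codegrees, the absence of stars with `s` edges bounds the
degrees. -/
lemma card_filter_mem_le_of_stars_eq_empty {E : Finset (Finset V)} {U : Finset V} {s k d : ℕ}
    (hk : ∀ e ∈ E, #e = k) (hk2 : 2 ≤ k) (hE : ∀ e ∈ E, e ⊆ U)
    (hd : ∀ u v, u ≠ v → #{e ∈ E | u ∈ e ∧ v ∈ e} ≤ d)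
    (h : stars E U s = ∅) (v : V) : #{e ∈ E | v ∈ e} ≤ s * (k * d) := by
  classical
  by_cases hv : v ∈ U
  swap
  · rw [filter_eq_empty_iff.2 fun e he hve => hv (hE e he hve)]
    simp
  let 𝓕 : Finset (Finset (Finset V)) := {F ∈ powerset {e ∈ E | v ∈ e} |
    ∀ e ∈ F, ∀ f ∈ F, e ≠ f → e ∩ f ⊆ {v}}
  have hne : 𝓕.Nonempty := ⟨∅, by simp [𝓕]⟩
  -- Take a largest star F centred at v. By maximality every edge through v shares a second vertex
  -- with some edge of F, so the codegree bound applies to fewer than s * k pairs.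
  obtain ⟨F, hF, hmax⟩ := exists_max_image 𝓕 card hne
  obtain ⟨hF1, hF2⟩ := mem_filter.1 hF
  rw [mem_powerset] at hF1
  have hcard : #F < s := by
    by_contra! hlt
    obtain ⟨F', hF', hs⟩ := exists_subset_card_eq hlt
    have : F'.biUnion id ∈ stars E U s := mem_stars.2 ⟨v, hv, F',
      fun e he => (mem_filter.1 (hF1 (hF' he))).1, fun e he => (mem_filter.1 (hF1 (hF' he))).2,
      hs, fun e he f hf => hF2 e (hF' he) f (hF' hf), rfl⟩
    rw [h] at this
    simp at this
  have hsub : {e ∈ E | v ∈ e} ⊆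
      F.biUnion fun f => (f.erase v).biUnion fun u => {e ∈ E | u ∈ e ∧ v ∈ e} := by
    intro e he
    obtain ⟨heE, hve⟩ := mem_filter.1 he
    have : ∃ f ∈ F, ∃ u ∈ f, u ≠ v ∧ u ∈ e := by
      by_cases heF : e ∈ F
      · have : (e.erase v).Nonempty := by
          rw [← card_pos, card_erase_of_mem hve, hk e heE]
          omega
        obtain ⟨u, hu⟩ := this
        exact ⟨e, heF, u, (mem_erase.1 hu).2, (mem_erase.1 hu).1, (mem_erase.1 hu).2⟩
      · by_contra! hcon
        have hmem : insert e F ∈ 𝓕 := by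
          refine mem_filter.2 ⟨mem_powerset.2 (insert_subset he hF1), ?_⟩
          have key : ∀ f ∈ F, f ∩ e ⊆ {v} := fun f hf u hu => by
            rw [mem_inter] at hu
            by_contra huv
            exact hcon f hf u hu.1 (by simpa using huv) hu.2
          intro f hf g hg hfg
          rw [mem_insert] at hf hg
          rcases hf with rfl | hf <;> rcases hg with rfl | hg
          · exact absurd rfl hfg
          · rw [inter_comm]; exact key g hg
          · exact key f hf
          · exact hF2 f hf g hg hfg
        have := hmax _ hmem
        rw [card_insert_of_notMem heF] at this
        omega
    obtain ⟨f, hf, u, huf, huv, hue⟩ := this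
    exact mem_biUnion.2 ⟨f, hf, mem_biUnion.2 ⟨u, mem_erase.2 ⟨huv, huf⟩,
      mem_filter.2 ⟨heE, hue, hve⟩⟩⟩
  refine (card_le_card hsub).trans ((card_biUnion_le_card_mul _ _ (k * d) fun f hf => ?_).trans
    (Nat.mul_le_mul_right _ hcard.le))
  refine (card_biUnion_le_card_mul _ _ d fun u hu => hd u v (mem_erase.1 hu).1).trans
    (Nat.mul_le_mul_right _ ?_)
  exact (card_erase_le).trans (hk f (mem_filter.1 (hF1 hf)).1).le

lemma card_filter_not_disjoint_le {J : Finset (Finset V)} {c : ℕ}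
    (h : ∀ v, #{e ∈ J | v ∈ e} ≤ c) (A : Finset V) : #{f ∈ J | ¬ Disjoint f A} ≤ #A * c := by
  have hsub : {f ∈ J | ¬ Disjoint f A} ⊆ A.biUnion fun v => {e ∈ J | v ∈ e} := by
    intro f hf
    rw [mem_filter, not_disjoint_iff] at hf
    obtain ⟨hfJ, v, hvf, hvA⟩ := hf
    exact mem_biUnion.2 ⟨v, hvA, mem_filter.2 ⟨hfJ, hvf⟩⟩
  exact (card_le_card hsub).trans (card_biUnion_le_card_mul _ _ _ fun v _ => h v)

/-- A hypergraph with few disjoint stars and no large star has a large subhypergraph of small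
degree. -/
lemma exists_subset_degree_le {G : Finset (Finset V)} {U : Finset V} {s r k d : ℕ}
    (hk : ∀ e ∈ G, #e = k) (hk2 : 2 ≤ k) (hG : ∀ e ∈ G, e ⊆ U)
    (hd : ∀ u v, u ≠ v → #{e ∈ G | u ∈ e ∧ v ∈ e} ≤ d)
    (h1 : disjointSeqCount (stars G U s) (r + 1) ∅ = 0) (h2 : stars G U ((r + 1) * s) = ∅) :
    ∃ J ⊆ G, (∀ v, #{e ∈ J | v ∈ e} ≤ s * (k * d)) ∧
      #G ≤ #J + r * (s * k) * ((r + 1) * s * (k * d)) := by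
  -- B meets every star of size s, so none survives among the edges disjoint from B. The absence of
  -- stars of size (r + 1) * s bounds the degrees at B, hence the number of lost edges.
  obtain ⟨B, hB, hB'⟩ := exists_cover_of_disjointSeqCount_eq_zero
    (fun e he => card_le_of_mem_stars hk he) r ∅ h1
  have hJ : {e ∈ G | Disjoint e B} ⊆ G := filter_subset _ _
  refine ⟨{e ∈ G | Disjoint e B}, hJ, ?_, ?_⟩
  · refine card_filter_mem_le_of_stars_eq_empty (U := U) (fun e he => hk e (hJ he)) hk2
      (fun e he => hG e (hJ he))
      (fun u v huv => (card_le_card (filter_subset_filter _ hJ)).trans (hd u v huv)) ?_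
    rw [eq_empty_iff_forall_notMem]
    intro T hT
    refine hB' T (stars_mono hJ U s hT) ?_
    obtain ⟨v, hv, F, hF, -, -, -, rfl⟩ := mem_stars.1 hT
    rw [disjoint_biUnion_left]
    exact fun e he => (mem_filter.1 (hF he)).2
  · have hdeg := card_filter_mem_le_of_stars_eq_empty hk hk2 hG hd h2
    have h3 := card_filter_not_disjoint_le hdeg B
    have h4 := card_filter_add_card_filter_not (s := G) (fun f => Disjoint f B)
    rw [card_empty, zero_add] at hB
    have h5 := Nat.mul_le_mul_right ((r + 1) * s * (k * d)) hB
    omega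

end Combinatorics

end UpperTail

/-! ### Probability bounds with free parameters. -/

namespace UpperTail

open Finset

variable {V : Type*} [DecidableEq V]

lemma within_mono (F : Finset (Finset V)) {S T : Finset V} (h : S ⊆ T) :
    within F S ⊆ within F T := fun e he => by
  rw [mem_within] at he ⊢
  exact ⟨he.1, he.2.trans h⟩

variable [Fintype V] {w : Finset V → ℝ} {U : Finset V} {p : ℝ} {E : Finset (Finset V)}

namespace IsBernoulliWeight

/-- The random hypergraph is unlikely to contain a subhypergraph of bounded degree that is much
larger than the mean. -/
lemma pr_exists_subset_le (hw : IsBernoulliWeight w U p) (hp : 0 ≤ p) (hE : ∀ e ∈ E, e ⊆ U)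
    {μ t : ℝ} (hμ : ∑ e ∈ E, p ^ #e = μ) (hμ0 : 0 < μ) (ht : 0 < t) {C : ℕ} (hC : 0 < C) :
    pr w {S | ∃ J ⊆ within E S, (∀ e ∈ J, #{f ∈ J | ¬ Disjoint f e} ≤ C) ∧
      μ + t / 2 ≤ (#J : ℝ)} ≤ Real.exp (-(t / (4 * C) * Real.log (1 + t / (4 * μ)))) := by
  have hC' : (0 : ℝ) < C := by exact_mod_cast hC
  -- For i < R the first i choices block at most i * C < t / 4 edges, so μ + t / 4 of the μ + t / 2
  -- remain available.
  set R := ⌈t / (4 * C)⌉₊ with hR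
  have hy : 0 < μ + t / 4 := by positivity
  have hlog : 0 ≤ Real.log (1 + t / (4 * μ)) := Real.log_nonneg (by
    have : 0 ≤ t / (4 * μ) := by positivity
    linarith)
  have h1 : pr w {S | ∃ J ⊆ within E S, (∀ e ∈ J, #{f ∈ J | ¬ Disjoint f e} ≤ C) ∧
      μ + t / 2 ≤ (#J : ℝ)} ≤
      pr w {S | (μ + t / 4) ^ R ≤ (disjointSeqCount (within E S) R ∅ : ℝ)} := by
    refine hw.pr_mono ?_
    rintro S ⟨J, hJ, hJC, hJt⟩
    refine (pow_le_disjointSeqCount hJC hy.le R ∅ fun i hi => ?_).trans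
      (Nat.cast_le.2 (disjointSeqCount_mono hJ R ∅))
    have hi' : (i : ℝ) < t / (4 * C) := Nat.lt_ceil.1 hi
    rw [lt_div_iff₀ (by positivity)] at hi'
    simp only [disjoint_empty_right, not_true_eq_false, filter_false, card_empty, Nat.cast_zero]
    linarith
  have h2 := hw.mul_pr_disjointSeqCount_le hp hE R ((μ + t / 4) ^ R)
  rw [hμ] at h2
  have h3 : pr w {S | (μ + t / 4) ^ R ≤ (disjointSeqCount (within E S) R ∅ : ℝ)} ≤
      (μ / (μ + t / 4)) ^ R := by
    rw [div_pow, le_div_iff₀ (by positivity), mul_comm]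
    exact h2
  have h4 : μ / (μ + t / 4) = Real.exp (-Real.log (1 + t / (4 * μ))) := by
    rw [Real.exp_neg, Real.exp_log (by positivity)]
    field_simp
  refine h1.trans (h3.trans ?_)
  rw [h4, ← Real.exp_nat_mul, Real.exp_le_exp]
  have := mul_le_mul_of_nonneg_right (Nat.le_ceil (t / (4 * C))) hlog
  linarith

/-- If every degree is at most `Δ` then there is no need to remove edges. -/
lemma pr_le_of_degree_le (hw : IsBernoulliWeight w U p) (hp : 0 ≤ p) (hE : ∀ e ∈ E, e ⊆ U)
    {μ t : ℝ} (hμ : ∑ e ∈ E, p ^ #e = μ) (hμ0 : 0 < μ) (ht : 0 < t) {k Δ : ℕ} (hk0 : 0 < k)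
    (hΔ0 : 0 < Δ) (hk : ∀ e ∈ E, #e = k) (hΔ : ∀ v, #{e ∈ E | v ∈ e} ≤ Δ) :
    pr w {S | μ + t ≤ (#(within E S) : ℝ)} ≤
      Real.exp (-(t / (4 * (k * Δ : ℕ)) * Real.log (1 + t / (4 * μ)))) := by
  refine le_trans (hw.pr_mono ?_) (hw.pr_exists_subset_le hp hE hμ hμ0 ht (Nat.mul_pos hk0 hΔ0))
  intro S hS
  simp only [Set.mem_ofPred_eq] at hS ⊢
  refine ⟨within E S, subset_rfl, fun e he => ?_, by linarith⟩
  rw [← hk e (mem_within.1 he).1]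
  exact card_filter_not_disjoint_le
    (fun v => (card_le_card (filter_subset_filter _ (filter_subset _ _))).trans (hΔ v)) e

/-- First moment bound applied to the vertex sets of stars instead of edges: at most `#U * Δ.choose
s` of them, each with at least (k - 1)s vertices. -/
lemma pr_disjoint_stars_le (hw : IsBernoulliWeight w U p) (hp : 0 ≤ p) (hp1 : p ≤ 1)
    (hE : ∀ e ∈ E, e ⊆ U) {k Δ : ℕ} (hk : ∀ e ∈ E, #e = k) (hΔ : ∀ v, #{e ∈ E | v ∈ e} ≤ Δ)
    (s r : ℕ) :
    pr w {S | disjointSeqCount (stars (within E S) U s) r ∅ ≠ 0} ≤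
      (#U * Δ.choose s * p ^ ((k - 1) * s)) ^ r := by
  have h := hw.mul_pr_disjointSeqCount_le hp
    (F := stars E U s) (fun T hT => subset_of_mem_stars hE hT) r 1
  rw [one_mul] at h
  refine (hw.pr_mono fun S hS => ?_).trans (h.trans ?_)
  · simp only [Set.mem_ofPred_eq, ne_eq] at hS ⊢
    have h1 := disjointSeqCount_mono (stars_within E U s S) r ∅
    exact_mod_cast (Nat.one_le_iff_ne_zero.2 hS).trans h1
  · refine pow_le_pow_left₀ (sum_nonneg fun T _ => by positivity) ?_ r
    calc ∑ T ∈ stars E U s, p ^ #T ≤ ∑ T ∈ stars E U s, p ^ ((k - 1) * s) :=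
          sum_le_sum fun T hT => pow_le_pow_of_le_one hp hp1 (le_card_of_mem_stars hk hT)
      _ = #(stars E U s) * p ^ ((k - 1) * s) := by rw [sum_const, nsmul_eq_mul]
      _ ≤ (#U * Δ.choose s) * p ^ ((k - 1) * s) := by
          gcongr
          exact_mod_cast card_stars_le hΔ

lemma pr_stars_le (hw : IsBernoulliWeight w U p) (hp : 0 ≤ p) (hp1 : p ≤ 1)
    (hE : ∀ e ∈ E, e ⊆ U) {k Δ : ℕ} (hk : ∀ e ∈ E, #e = k) (hΔ : ∀ v, #{e ∈ E | v ∈ e} ≤ Δ)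
    (s : ℕ) :
    pr w {S | stars (within E S) U s ≠ ∅} ≤ #U * Δ.choose s * p ^ ((k - 1) * s) := by
  have h := hw.pr_disjoint_stars_le hp hp1 hE hk hΔ s 1
  rw [pow_one] at h
  refine (hw.pr_mono fun S hS => ?_).trans h
  simpa [disjointSeqCount, filter_true_of_mem] using hS

/-- The upper tail bound in terms of the expected numbers of stars. -/
lemma pr_le_of_stars (hw : IsBernoulliWeight w U p) (hp : 0 ≤ p) (hp1 : p ≤ 1)
    (hE : ∀ e ∈ E, e ⊆ U) {μ t : ℝ} (hμ : ∑ e ∈ E, p ^ #e = μ) (hμ0 : 0 < μ) (ht : 0 < t)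
    {k d Δ s r : ℕ} (hk2 : 2 ≤ k) (hd0 : 0 < d) (hs0 : 0 < s) (hk : ∀ e ∈ E, #e = k)
    (hd : ∀ u v, u ≠ v → #{e ∈ E | u ∈ e ∧ v ∈ e} ≤ d) (hΔ : ∀ v, #{e ∈ E | v ∈ e} ≤ Δ)
    (hr : ((r * (s * k) * ((r + 1) * s * (k * d)) : ℕ) : ℝ) ≤ t / 2) :
    pr w {S | μ + t ≤ (#(within E S) : ℝ)} ≤
      Real.exp (-(t / (4 * (k * (s * (k * d)) : ℕ)) * Real.log (1 + t / (4 * μ)))) +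
        ((#U * Δ.choose s * p ^ ((k - 1) * s)) ^ (r + 1) +
          #U * Δ.choose ((r + 1) * s) * p ^ ((k - 1) * ((r + 1) * s))) := by
  have h1 := hw.pr_exists_subset_le hp hE hμ hμ0 ht
    (C := k * (s * (k * d))) (by positivity)
  have h2 := hw.pr_disjoint_stars_le hp hp1 hE hk hΔ s (r + 1)
  have h3 := hw.pr_stars_le hp hp1 hE hk hΔ ((r + 1) * s)
  refine le_trans (le_trans (hw.pr_mono ?_) (hw.pr_union_le _ _)) (add_le_add h1
    (le_trans (hw.pr_union_le _ _) (add_le_add h2 h3)))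
  intro S hS
  by_contra hcon
  simp only [Set.mem_union, not_or, Set.mem_ofPred_eq, not_not] at hcon hS
  obtain ⟨hA, hB, hC⟩ := hcon
  have hsub : within E S ⊆ E := filter_subset _ _
  obtain ⟨J, hJ, hJd, hJc⟩ := exists_subset_degree_le (fun e he => hk e (hsub he)) hk2
    (fun e he => hE e (hsub he))
    (fun u v huv => (card_le_card (filter_subset_filter _ hsub)).trans (hd u v huv)) hB hC
  refine hA ⟨J, hJ, fun e he => ?_, ?_⟩
  · rw [← hk e (hsub (hJ he))]
    exact (card_filter_not_disjoint_le hJd e).trans (by rw [hk e (hsub (hJ he))])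
  · have : (#(within E S) : ℝ) ≤
        #J + ((r * (s * k) * ((r + 1) * s * (k * d)) : ℕ) : ℝ) := by exact_mod_cast hJc
    linarith

/-- The second moment method: a lower bound for the probability that the random set contains an
edge. -/
lemma le_pr_within_nonempty (hw : IsBernoulliWeight w U p) (hp : 0 < p) (hp1 : p ≤ 1)
    (hE : ∀ e ∈ E, e ⊆ U) {k d Δ : ℕ} (hk1 : 1 ≤ k) (hk : ∀ e ∈ E, #e = k)
    (hd : ∀ u v, u ≠ v → #{e ∈ E | u ∈ e ∧ v ∈ e} ≤ d) (hΔ : ∀ v, #{e ∈ E | v ∈ e} ≤ Δ)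
    {c : ℝ} (hc : Δ * p ^ (k - 1) ≤ c) (hne : E.Nonempty) (h1 : #E * p ^ k ≤ 1) :
    #E * p ^ k / (1 + k * c + k * k * d) ≤ pr w {S | (within E S).Nonempty} := by
  classical
  set m : ℝ := #E * p ^ k with hm
  have hm0 : 0 < m := by
    have : 0 < #E := card_pos.2 hne
    positivity
  have hmean : ∑ S, w S * (#(within E S) : ℝ) = m := by
    rw [hw.sum_mul_card_within hE, sum_congr rfl fun e he => by rw [hk e he]]
    rw [sum_const, nsmul_eq_mul]
  have hsq : ∑ S, w S * (#(within E S) : ℝ) ^ 2 = ∑ e ∈ E, ∑ f ∈ E, p ^ #(e ∪ f) := by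
    have h (S : Finset V) : w S * (#(within E S) : ℝ) ^ 2 =
        ∑ e ∈ E, ∑ f ∈ E, w S * (if e ∪ f ⊆ S then 1 else 0) := by
      have : (#(within E S) : ℝ) = ∑ e ∈ E, if e ⊆ S then (1 : ℝ) else 0 := by
        rw [within, card_filter]; push_cast; rfl
      rw [this, sq, sum_mul_sum, mul_sum]
      refine sum_congr rfl fun e _ => ?_
      rw [mul_sum]
      refine sum_congr rfl fun f _ => ?_
      by_cases h1 : e ⊆ S <;> by_cases h2 : f ⊆ S <;> simp [h1, h2, union_subset_iff]
    simp_rw [h]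
    rw [sum_comm]
    refine sum_congr rfl fun e he => ?_
    rw [sum_comm]
    refine sum_congr rfl fun f hf => ?_
    rw [← hw.pr_superset (e ∪ f) (union_subset (hE e he) (hE f hf)), pr_eq_sum_mul]
    rfl
  have hc0 : 0 ≤ c := le_trans (by positivity) hc
  have hinner : ∀ e ∈ E, ∑ f ∈ E, p ^ #(e ∪ f) ≤ p ^ k * (1 + k * c + k * k * d) := by
    intro e he
    -- The three terms cover intersections of size 0, 1 and at least 2. After summing over f they
    -- are bounded by the mean, by the degrees and by the codegrees.
    have hpt : ∀ f ∈ E, p ^ #(e ∪ f) ≤ p ^ k * (p ^ k +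
        ((∑ v ∈ e, if v ∈ f then p ^ (k - 1) else 0) +
          ∑ u ∈ e, ∑ v ∈ e.erase u, if u ∈ f ∧ v ∈ f then (1 : ℝ) else 0)) := by
      intro f hf
      have hA : 0 ≤ ∑ v ∈ e, if v ∈ f then p ^ (k - 1) else 0 :=
        sum_nonneg fun v _ => by split_ifs <;> positivity
      have hB : 0 ≤ ∑ u ∈ e, ∑ v ∈ e.erase u, if u ∈ f ∧ v ∈ f then (1 : ℝ) else 0 :=
        sum_nonneg fun u _ => sum_nonneg fun v _ => by split_ifs <;> positivity
      have hun := card_union_add_card_inter e f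
      rw [hk e he, hk f hf] at hun
      have hle : #(e ∩ f) ≤ k := (card_le_card inter_subset_left).trans (hk e he).le
      have hun' : #(e ∪ f) = k + (k - #(e ∩ f)) := by omega
      rw [hun', pow_add]
      refine mul_le_mul_of_nonneg_left ?_ (by positivity)
      have hpk : 0 ≤ p ^ k := by positivity
      rcases Nat.lt_or_ge 1 #(e ∩ f) with h2 | h2
      · obtain ⟨u, hu, v, hv, huv⟩ := one_lt_card.1 h2
        rw [mem_inter] at hu hv
        have hin : (1 : ℝ) ≤ ∑ u ∈ e, ∑ v ∈ e.erase u, if u ∈ f ∧ v ∈ f then (1 : ℝ) else 0 := by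
          refine le_trans ?_ (single_le_sum (f := fun u => ∑ v ∈ e.erase u,
            if u ∈ f ∧ v ∈ f then (1 : ℝ) else 0)
            (fun u _ => sum_nonneg fun v _ => by split_ifs <;> positivity) hu.1)
          refine le_trans ?_ (single_le_sum (f := fun v => if u ∈ f ∧ v ∈ f then (1 : ℝ) else 0)
            (fun v _ => by split_ifs <;> positivity) (mem_erase.2 ⟨huv.symm, hv.1⟩))
          simp [hu.2, hv.2]
        have := pow_le_one₀ (n := k - #(e ∩ f)) hp.le hp1
        linarith
      · rcases Nat.eq_zero_or_pos #(e ∩ f) with h0 | h0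
        · rw [h0, Nat.sub_zero]
          linarith
        · have h1 : #(e ∩ f) = 1 := by omega
          rw [h1]
          obtain ⟨v, hv⟩ := card_pos.1 h0
          rw [mem_inter] at hv
          have := single_le_sum (f := fun v => if v ∈ f then p ^ (k - 1) else 0)
            (fun u _ => by split_ifs <;> positivity) hv.1
          simp only [hv.2, if_true] at this
          linarith
    have hA : ∑ f ∈ E, ∑ v ∈ e, (if v ∈ f then p ^ (k - 1) else 0) ≤ k * c := by
      rw [sum_comm]
      calc ∑ v ∈ e, ∑ f ∈ E, (if v ∈ f then p ^ (k - 1) else 0) ≤ ∑ v ∈ e, c := by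
            refine sum_le_sum fun v _ => le_trans ?_ hc
            rw [← sum_filter, sum_const, nsmul_eq_mul]
            gcongr
            exact hΔ v
        _ = k * c := by rw [sum_const, hk e he, nsmul_eq_mul]
    have hB : ∑ f ∈ E, ∑ u ∈ e, ∑ v ∈ e.erase u, (if u ∈ f ∧ v ∈ f then (1 : ℝ) else 0) ≤
        k * k * d := by
      rw [sum_comm]
      calc ∑ u ∈ e, ∑ f ∈ E, ∑ v ∈ e.erase u, (if u ∈ f ∧ v ∈ f then (1 : ℝ) else 0)
          ≤ ∑ u ∈ e, (k * d : ℝ) := by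
            refine sum_le_sum fun u _ => ?_
            rw [sum_comm]
            calc ∑ v ∈ e.erase u, ∑ f ∈ E, (if u ∈ f ∧ v ∈ f then (1 : ℝ) else 0)
                ≤ ∑ v ∈ e.erase u, (d : ℝ) := by
                  refine sum_le_sum fun v hv => ?_
                  rw [← sum_filter, sum_const, nsmul_eq_mul, mul_one]
                  exact_mod_cast hd u v (mem_erase.1 hv).1.symm
              _ ≤ k * d := by
                  rw [sum_const, nsmul_eq_mul]
                  gcongr
                  exact card_erase_le.trans (hk e he).le
        _ = k * k * d := by rw [sum_const, hk e he, nsmul_eq_mul, mul_assoc]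
    calc ∑ f ∈ E, p ^ #(e ∪ f) ≤ _ := sum_le_sum hpt
      _ = p ^ k * (m + (∑ f ∈ E, ∑ v ∈ e, (if v ∈ f then p ^ (k - 1) else 0) +
          ∑ f ∈ E, ∑ u ∈ e, ∑ v ∈ e.erase u, (if u ∈ f ∧ v ∈ f then (1 : ℝ) else 0))) := by
          rw [← mul_sum, sum_add_distrib, sum_add_distrib, sum_const, nsmul_eq_mul, hm]
      _ ≤ p ^ k * (1 + k * c + k * k * d) := by
          refine mul_le_mul_of_nonneg_left ?_ (by positivity)
          linarith
  have hsq' : ∑ S, w S * (#(within E S) : ℝ) ^ 2 ≤ m * (1 + k * c + k * k * d) := by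
    rw [hsq]
    refine (sum_le_sum hinner).trans_eq ?_
    rw [sum_const, nsmul_eq_mul, hm]
    ring
  -- Cauchy–Schwarz: (𝔼 X)² ≤ 𝔼 X² · P(X > 0).
  have hCS := sum_sq_le_sum_mul_sum_of_sq_le_mul univ
    (r := fun S => w S * (#(within E S) : ℝ)) (f := fun S => w S * (#(within E S) : ℝ) ^ 2)
    (g := fun S => {S | (within E S).Nonempty}.indicator w S)
    (fun S _ => mul_nonneg (hw.nonneg S) (by positivity))
    (fun S _ => Set.indicator_nonneg (fun S _ => hw.nonneg S) S)
    (fun S _ => le_of_eq <| by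
      by_cases h : (within E S).Nonempty
      · simp only [Set.indicator_apply, Set.mem_ofPred_eq, h, if_true]
        ring
      · rw [not_nonempty_iff_eq_empty] at h
        simp [h])
  rw [hmean] at hCS
  have hK : (0 : ℝ) < 1 + k * c + k * k * d := by positivity
  have hP := hw.pr_nonneg {S | (within E S).Nonempty}
  rw [div_le_iff₀ hK]
  refine le_of_mul_le_mul_left ?_ hm0
  calc m * m = m ^ 2 := by ring
    _ ≤ _ := hCS
    _ ≤ (m * (1 + k * c + k * k * d)) * pr w {S | (within E S).Nonempty} :=
        mul_le_mul_of_nonneg_right hsq' hP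
    _ = _ := by ring

/-- If all sets of `q` edges have probability at least `β` to be hit, then there are `m` edges
with probability at least `β ^ m`. -/
lemma pow_le_pr_of_hit (hw : IsBernoulliWeight w U p) {β : ℝ} (hβ : 0 ≤ β) {q : ℕ}
    (hq : ∀ F ⊆ E, #F = q → β ≤ pr w {S | (within F S).Nonempty}) (m : ℕ)
    {F : Finset (Finset V)} (hF : F ⊆ E) (hFm : m * q ≤ #F) :
    β ^ m ≤ pr w {S | m ≤ #(within F S)} := by
  induction m generalizing F with
  | zero => simpa using hw.pr_univ.ge
  | succ m ih =>
    rw [Nat.succ_mul] at hFm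
    obtain ⟨G, hGF, hG⟩ := exists_subset_card_eq (show q ≤ #F by omega)
    have h1 := hq G (hGF.trans hF) hG
    have h2 := ih (F := F \ G) (sdiff_subset.trans hF)
      (by rw [card_sdiff_of_subset hGF]; omega)
    have hup1 : IsUpperSet {S | (within G S).Nonempty} :=
      fun S T hST h => h.mono (within_mono G hST)
    have hup2 : IsUpperSet {S | m ≤ #(within (F \ G) S)} :=
      fun S T hST h => le_trans h (card_le_card (within_mono _ hST))
    rw [pow_succ']
    refine (mul_le_mul h1 h2 (by positivity) (hw.pr_nonneg _)).trans
      ((hw.pr_mul_pr_le hup1 hup2).trans (hw.pr_mono ?_))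
    rintro S ⟨hS1, hS2⟩
    simp only [Set.mem_ofPred_eq] at hS1 hS2 ⊢
    have hdisj : Disjoint (within G S) (within (F \ G) S) :=
      disjoint_of_subset_left (filter_subset _ _)
        (disjoint_of_subset_right (filter_subset _ _) disjoint_sdiff)
    have hsub : within G S ∪ within (F \ G) S ⊆ within F S :=
      union_subset (filter_subset_filter _ hGF) (filter_subset_filter _ sdiff_subset)
    have h3 := card_le_card hsub
    rw [card_union_of_disjoint hdisj] at h3
    have := card_pos.2 hS1
    omega

/-- A Poisson-type lower bound for the upper tail. -/
lemma pow_le_pr_of_le_card (hw : IsBernoulliWeight w U p) (hp : 0 < p) (hp1 : p ≤ 1)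
    (hE : ∀ e ∈ E, e ⊆ U) {k d Δ m : ℕ} (hk1 : 1 ≤ k) (hk : ∀ e ∈ E, #e = k)
    (hd : ∀ u v, u ≠ v → #{e ∈ E | u ∈ e ∧ v ∈ e} ≤ d) (hΔ : ∀ v, #{e ∈ E | v ∈ e} ≤ Δ)
    {c : ℝ} (hc : Δ * p ^ (k - 1) ≤ c) (hm0 : 0 < m) (hm : m ≤ #E) (hμm : #E * p ^ k ≤ m) :
    (#E * p ^ k / (2 * m * (1 + k * c + k * k * d))) ^ m ≤ pr w {S | m ≤ #(within E S)} := by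
  have hc0 : 0 ≤ c := le_trans (by positivity) hc
  have hm0' : (0 : ℝ) < m := by exact_mod_cast hm0
  have hK : (0 : ℝ) < 1 + k * c + k * k * d := by positivity
  -- Block size. Since q ≥ 1, rounding down loses at most a factor 2; since the mean is at most m, a
  -- block has mean at most 1, as the second moment bound requires.
  set q := #E / m with hq
  have hq1 : 1 ≤ q := (Nat.one_le_div_iff hm0).2 hm
  have hqm : m * q ≤ #E := Nat.mul_div_le _ _
  have hqm' : (m : ℝ) * q ≤ #E := by exact_mod_cast hqm
  have hq2 : #E ≤ 2 * m * q := by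
    have h1 := Nat.lt_mul_div_succ #E hm0
    rw [← hq] at h1
    nlinarith
  have hq2' : (#E : ℝ) ≤ 2 * m * q := by exact_mod_cast hq2
  have hpk : 0 < p ^ k := by positivity
  refine le_trans (pow_le_pow_left₀ (by positivity) ?_ m)
    (hw.pow_le_pr_of_hit (E := E) (β := q * p ^ k / (1 + k * c + k * k * d)) (q := q)
      (by positivity) ?_ m subset_rfl hqm)
  · rw [div_le_div_iff₀ (by positivity) hK]
    nlinarith [mul_le_mul_of_nonneg_right hq2' (mul_pos hpk hK).le]
  · intro F hF hFq
    rw [← hFq]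
    refine hw.le_pr_within_nonempty hp hp1 (fun e he => hE e (hF he)) hk1
      (fun e he => hk e (hF he))
      (fun u v huv => (card_le_card (filter_subset_filter _ hF)).trans (hd u v huv))
      (fun v => (card_le_card (filter_subset_filter _ hF)).trans (hΔ v)) hc
      (card_pos.1 (by omega)) ?_
    rw [hFq]
    refine le_of_mul_le_mul_left ?_ hm0'
    nlinarith [mul_le_mul_of_nonneg_right hqm' hpk.le]

end IsBernoulliWeight

end UpperTail

/-! ### Numerical estimates, and the upper bound for sparse and dense p. -/

namespace UpperTail

open Finset

/-- The expected number of stars with `s` edges is tiny if `s` is not too small. -/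
lemma star_bound {k : ℕ} (hk : 3 ≤ k) {a D n x z : ℝ} {N Δ s : ℕ} (ha : 0 < a) (hD : 1 ≤ D)
    (hn : 0 < n) (hN : N ≤ D * n) (hΔ : Δ ≤ D ^ 2 * n) (hx : a * n ^ 2 * (z ^ 8) ^ k ≤ x)
    (hz : 0 < z) (hz1 : z ≤ 1 / 2) (hz2 : 27 * D ^ 2 * z ≤ √a) (hs : 8 * k + 4 ≤ s)
    (hsx : √x ≤ s * (1 + Real.log (1 / z ^ 8))) :
    N * Δ.choose s * (z ^ 8) ^ ((k - 1) * s) ≤ z ^ s := by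
  have hsa : 0 < √a := Real.sqrt_pos.2 ha
  have hs0 : (0 : ℝ) < s := by
    have : 0 < s := by omega
    exact_mod_cast this
  -- Writing p = z ^ 8 keeps all powers of p in this argument integral powers of z.
  have h1 : √a * n * z ^ (4 * k) ≤ √x := by
    refine Real.le_sqrt_of_sq_le (le_trans (le_of_eq ?_) hx)
    rw [mul_pow, mul_pow, Real.sq_sqrt ha.le, ← pow_mul, ← pow_mul]
    ring_nf
  have hL : (1 + Real.log (1 / z ^ 8)) * z ≤ 9 := by
    have : Real.log (1 / z ^ 8) = 8 * Real.log (1 / z) := by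
      rw [← one_div_pow, Real.log_pow]; norm_num
    rw [this]
    have h2 := Real.log_le_sub_one_of_pos (show 0 < 1 / z by positivity)
    have h3 : 1 / z * z = 1 := by field_simp
    nlinarith
  have h2 : √a * n * z ^ (4 * k + 1) ≤ 9 * s := by
    calc √a * n * z ^ (4 * k + 1) = (√a * n * z ^ (4 * k)) * z := by ring
      _ ≤ (s * (1 + Real.log (1 / z ^ 8))) * z :=
          mul_le_mul_of_nonneg_right (h1.trans hsx) hz.le
      _ = s * ((1 + Real.log (1 / z ^ 8)) * z) := by ring
      _ ≤ s * 9 := by gcongr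
      _ = 9 * s := by ring
  have hz1' : z ≤ 1 := by linarith
  -- Here k ≥ 3 is essential: 8(k - 1) = (4k + 1) + 3 + 4(k - 3). The first part cancels n up to a
  -- factor 9s; the spare z ^ 3 leaves z ^ 2 and one z to absorb the constants.
  have h3 : 3 * Δ * z ^ (8 * (k - 1)) ≤ s * z ^ 2 := by
    obtain ⟨j, rfl⟩ : ∃ j, k = j + 3 := ⟨k - 3, by omega⟩
    have e1 : z ^ (8 * (j + 3 - 1)) = z ^ (4 * (j + 3) + 1) * (z ^ 3 * z ^ (4 * j)) := by
      rw [← pow_add, ← pow_add]; congr 1; omega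
    have e2 : z ^ (4 * j) ≤ 1 := pow_le_one₀ hz.le hz1'
    refine le_of_mul_le_mul_left ?_ hsa
    calc √a * (3 * Δ * z ^ (8 * (j + 3 - 1)))
        ≤ √a * (3 * (D ^ 2 * n) * (z ^ (4 * (j + 3) + 1) * (z ^ 3 * 1))) := by
          rw [e1]; gcongr
      _ = 3 * D ^ 2 * z ^ 3 * (√a * n * z ^ (4 * (j + 3) + 1)) := by ring
      _ ≤ 3 * D ^ 2 * z ^ 3 * (9 * s) := by gcongr
      _ = (27 * D ^ 2 * z) * (s * z ^ 2) := by ring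
      _ ≤ √a * (s * z ^ 2) := by gcongr
  have h4 : (Δ.choose s : ℝ) * (z ^ 8) ^ ((k - 1) * s) ≤ (z ^ 2) ^ s := by
    have hfac : (s : ℝ) ^ s ≤ 3 ^ s * (s.factorial : ℝ) := by
      have h := Real.pow_div_factorial_le_exp (s : ℝ) hs0.le s
      rw [div_le_iff₀ (by positivity)] at h
      refine h.trans ?_
      gcongr
      rw [← Real.exp_one_pow]
      gcongr
      exact Real.exp_one_lt_three.le
    have hch := Nat.choose_le_pow_div (α := ℝ) s Δ
    rw [le_div_iff₀ (by positivity)] at hch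
    have hfp : (0 : ℝ) < s.factorial := by positivity
    refine le_of_mul_le_mul_left ?_ (show (0 : ℝ) < s ^ s by positivity)
    calc (s : ℝ) ^ s * ((Δ.choose s : ℝ) * (z ^ 8) ^ ((k - 1) * s))
        ≤ (3 ^ s * (s.factorial : ℝ)) * ((Δ.choose s : ℝ) * (z ^ 8) ^ ((k - 1) * s)) := by gcongr
      _ = 3 ^ s * (z ^ 8) ^ ((k - 1) * s) * ((Δ.choose s : ℝ) * s.factorial) := by ring
      _ ≤ 3 ^ s * (z ^ 8) ^ ((k - 1) * s) * Δ ^ s := by gcongr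
      _ = (3 * Δ * z ^ (8 * (k - 1))) ^ s := by
          rw [mul_pow, mul_pow, ← pow_mul, ← pow_mul, ← mul_assoc]; ring
      _ ≤ (s * z ^ 2) ^ s := by gcongr
      _ = s ^ s * (z ^ 2) ^ s := by rw [mul_pow]
  have h5 : N * z ^ (4 * k + 2) ≤ s := by
    refine le_of_mul_le_mul_left ?_ hsa
    have hDz : 9 * D * z ≤ √a := by nlinarith
    calc √a * (N * z ^ (4 * k + 2)) ≤ √a * (D * n * z ^ (4 * k + 2)) := by gcongr
      _ = D * z * (√a * n * z ^ (4 * k + 1)) := by ring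
      _ ≤ D * z * (9 * s) := by gcongr
      _ = (9 * D * z) * s := by ring
      _ ≤ √a * s := by gcongr
  obtain ⟨m, hm⟩ : ∃ m, s = 4 * k + 2 + m := ⟨s - (4 * k + 2), by omega⟩
  -- As s ≥ 8k + 4, at least half of s remains in m, so s ≤ 2m ≤ 2 ^ m.
  have h6 : s * z ^ m ≤ 1 := by
    have h7 : s ≤ 2 ^ m := by
      have h8 : 2 * (m - 1 + 1) ≤ 2 * 2 ^ (m - 1) := by
        have := (m - 1).lt_two_pow_self
        omega
      rw [← pow_succ', show m - 1 + 1 = m by omega] at h8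
      omega
    have h9 : (s : ℝ) ≤ 2 ^ m := by exact_mod_cast h7
    calc s * z ^ m ≤ 2 ^ m * (1 / 2) ^ m := by gcongr
      _ = 1 := by rw [← mul_pow]; norm_num
  calc N * Δ.choose s * (z ^ 8) ^ ((k - 1) * s)
      = N * (Δ.choose s * (z ^ 8) ^ ((k - 1) * s)) := by ring
    _ ≤ N * (z ^ 2) ^ s := by gcongr
    _ = (N * z ^ (4 * k + 2)) * z ^ m * z ^ s := by
        rw [hm]; ring
    _ ≤ s * z ^ m * z ^ s := by gcongr
    _ ≤ 1 * z ^ s := by gcongr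
    _ = z ^ s := one_mul _

/-- The right side is at least ε²/(4 + ε). The factor √(1 + ε) comes from the star size s, which
grows like √((1 + ε)μ); dividing by it leaves √ε for large ε. -/
lemma min_le_mul_log {ε : ℝ} (hε : 0 < ε) :
    min (ε ^ 2) √ε / 8 * √(1 + ε) ≤ ε * Real.log (1 + ε / 4) := by
  have h1 : ε / (4 + ε) ≤ Real.log (1 + ε / 4) := by
    refine le_trans (le_of_eq ?_) (Real.one_sub_inv_le_log_of_pos (by positivity))
    field_simp
    ring
  refine le_trans ?_ (mul_le_mul_of_nonneg_left h1 hε.le)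
  rw [mul_div_assoc', le_div_iff₀ (by positivity)]
  rcases le_total ε 1 with h | h
  · have h2 : √(1 + ε) ≤ 8 / 5 := Real.sqrt_le_iff.2 ⟨by norm_num, by linarith⟩
    calc min (ε ^ 2) √ε / 8 * √(1 + ε) * (4 + ε) ≤ ε ^ 2 / 8 * (8 / 5) * (4 + 1) := by
          gcongr
          exact min_le_left _ _
      _ = ε * ε := by ring
  · have h2 : √(1 + ε) ≤ 8 / 5 * √ε := by
      refine Real.sqrt_le_iff.2 ⟨by positivity, ?_⟩
      rw [mul_pow, Real.sq_sqrt hε.le]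
      linarith
    calc min (ε ^ 2) √ε / 8 * √(1 + ε) * (4 + ε) ≤ √ε / 8 * (8 / 5 * √ε) * (4 * ε + ε) := by
          gcongr
          · exact min_le_right _ _
          · linarith
      _ = √ε ^ 2 * ε := by ring
      _ = ε * ε := by rw [Real.sq_sqrt hε.le]

lemma min_cube_le {ε : ℝ} (hε : 0 < ε) :
    min (ε ^ 3) √ε ≤ min 1 ε * min (ε ^ 2) √ε := by
  rcases le_total ε 1 with h | h
  · have h1 : ε ^ 2 ≤ √ε := by
      refine Real.le_sqrt_of_sq_le ?_
      calc (ε ^ 2) ^ 2 = ε * ε ^ 3 := by ring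
        _ ≤ ε * 1 := by gcongr; exact pow_le_one₀ hε.le h
        _ = ε := mul_one ε
    rw [min_eq_right h, min_eq_left h1]
    exact (min_le_left _ _).trans_eq (by ring)
  · have h1 : √ε ≤ ε ^ 2 := by
      rw [Real.sqrt_le_left (by positivity)]
      calc ε = ε * 1 := (mul_one ε).symm
        _ ≤ ε * ε ^ 3 := by gcongr; exact one_le_pow₀ h
        _ = (ε ^ 2) ^ 2 := by ring
    rw [min_eq_left h, min_eq_right h1, one_mul]
    exact min_le_right _ _

lemma half_min_le_log {ε : ℝ} (hε : 0 < ε) : min 1 ε / 2 ≤ Real.log (1 + ε) := by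
  have h1 : ε / (1 + ε) ≤ Real.log (1 + ε) := by
    refine le_trans (le_of_eq ?_) (Real.one_sub_inv_le_log_of_pos (by positivity))
    field_simp
    ring
  refine le_trans ?_ h1
  rw [div_le_div_iff₀ (by norm_num) (by positivity)]
  rcases le_total ε 1 with h | h
  · rw [min_eq_right h]; nlinarith
  · rw [min_eq_left h]; linarith

/-- Take r + 1 = max(⌊τ/s⌋, 1). If s > τ then r = 0, and the deletion argument removes no edge, so
no upper bound on (r + 1)s is needed. -/
lemma exists_succ_mul_le {τ s : ℝ} (hs : 0 < s) (hτ : 0 ≤ τ) :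
    ∃ r : ℕ, (r = 0 ∨ ((r + 1 : ℕ) : ℝ) * s ≤ τ) ∧ τ / 2 ≤ ((r + 1 : ℕ) : ℝ) * s := by
  rcases Nat.eq_zero_or_pos ⌊τ / s⌋₊ with h0 | h0
  · refine ⟨0, Or.inl rfl, ?_⟩
    rw [Nat.floor_eq_zero, div_lt_one hs] at h0
    push_cast
    linarith
  · refine ⟨⌊τ / s⌋₊ - 1, Or.inr ?_, ?_⟩
    · rw [Nat.sub_add_cancel h0]
      have := Nat.floor_le (show 0 ≤ τ / s by positivity)
      rwa [le_div_iff₀ hs] at this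
    · rw [Nat.sub_add_cancel h0]
      have h1 := Nat.lt_floor_add_one (τ / s)
      rw [div_lt_iff₀ hs] at h1
      have h2 : (1 : ℝ) ≤ ⌊τ / s⌋₊ := by exact_mod_cast h0
      nlinarith

/-- The two terms of the minimum match the two terms of the maximum: μ is used against 8k + 4 and √μ
L against √((1 + ε)μ)/L. -/
lemma tail_exponent_le {ε μ L k d s : ℝ} (hε : 0 < ε) (hμ : 0 < μ) (hL : 0 < L) (hk : 0 < k)
    (hd : 0 < d) (hs : 0 < s) (hsM : s ≤ 2 * max (8 * k + 4) (√((1 + ε) * μ) / L)) :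
    1 / (64 * k ^ 2 * d * (8 * k + 4)) * min (ε ^ 2) √ε * min μ (√μ * L) ≤
      ε * μ / (4 * (k * (s * (k * d)))) * Real.log (1 + ε / 4) := by
  have hlog := min_le_mul_log hε
  set g := min (ε ^ 2) √ε
  set m := min μ (√μ * L) with hm
  set M := max (8 * k + 4) (√((1 + ε) * μ) / L) with hM
  have hg0 : 0 ≤ g := le_min (by positivity) (by positivity)
  have hm0 : 0 ≤ m := le_min hμ.le (by positivity)
  have hmM : m * M ≤ (8 * k + 4) * √(1 + ε) * μ := by
    have hsq1 : 1 ≤ √(1 + ε) := Real.one_le_sqrt.2 (by linarith)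
    rw [hM, mul_max_of_nonneg _ _ hm0, max_le_iff]
    constructor
    · calc m * (8 * k + 4) ≤ μ * (8 * k + 4) := by gcongr; exact min_le_left _ _
        _ = (8 * k + 4) * 1 * μ := by ring
        _ ≤ _ := by gcongr
    · calc m * (√((1 + ε) * μ) / L) ≤ (√μ * L) * (√((1 + ε) * μ) / L) := by
            gcongr; exact min_le_right _ _
        _ = √((1 + ε) * μ) * √μ := by field_simp
        _ = √(1 + ε) * (√μ) ^ 2 := by rw [Real.sqrt_mul (by positivity)]; ring
        _ = 1 * √(1 + ε) * μ := by rw [Real.sq_sqrt hμ.le]; ring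
        _ ≤ _ := by gcongr; linarith
  rw [div_mul_eq_mul_div, one_mul, div_mul_eq_mul_div, div_mul_eq_mul_div,
    div_le_div_iff₀ (by positivity) (by positivity)]
  calc g * m * (4 * (k * (s * (k * d)))) = g * m * (4 * k ^ 2 * d) * s := by ring
    _ ≤ g * m * (4 * k ^ 2 * d) * (2 * M) := by gcongr
    _ = g * (8 * k ^ 2 * d) * (m * M) := by ring
    _ ≤ g * (8 * k ^ 2 * d) * ((8 * k + 4) * √(1 + ε) * μ) := by gcongr
    _ = (g / 8 * √(1 + ε)) * (64 * k ^ 2 * d * (8 * k + 4) * μ) := by ring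
    _ ≤ (ε * Real.log (1 + ε / 4)) * (64 * k ^ 2 * d * (8 * k + 4) * μ) := by gcongr
    _ = ε * μ * Real.log (1 + ε / 4) * (64 * k ^ 2 * d * (8 * k + 4)) := by ring

lemma star_exponent_le {ε μ L k d : ℝ} (hε : 0 < ε) (hμ : 0 < μ) (hL : 0 < L) (hk : 1 ≤ k)
    (hd : 0 < d) :
    1 / (64 * k ^ 2 * d * (8 * k + 4)) * min (ε ^ 2) √ε * min μ (√μ * L) ≤
      √(ε * μ) / (2 * k * d) / 2 * (L / 16) := by
  have hcle : 1 / (64 * k ^ 2 * d * (8 * k + 4)) ≤ 1 / (64 * k * d) := by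
    refine one_div_le_one_div_of_le (by positivity) ?_
    have h3 : 1 ≤ k * (8 * k + 4) := by nlinarith
    calc 64 * k * d = 64 * k * d * 1 := by ring
      _ ≤ 64 * k * d * (k * (8 * k + 4)) := by gcongr
      _ = _ := by ring
  calc 1 / (64 * k ^ 2 * d * (8 * k + 4)) * min (ε ^ 2) √ε * min μ (√μ * L)
      ≤ 1 / (64 * k * d) * √ε * (√μ * L) := by
        gcongr
        · exact min_le_right _ _
        · exact min_le_right _ _
    _ = √(ε * μ) / (2 * k * d) / 2 * (L / 16) := by
        rw [Real.sqrt_mul hε.le]; field_simp; norm_num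

/-- Combining an exponential bound with Markov's inequality to remove a constant factor. -/
lemma le_exp_of_le_three_mul {P c ε m : ℝ} (hc : 0 < c) (hε : 0 < ε) (hm : 0 ≤ m)
    (h1 : P ≤ 3 * Real.exp (-(c * min (ε ^ 2) √ε * m))) (h2 : P ≤ 1 / (1 + ε)) :
    P ≤ Real.exp (-(c / 8 * min (ε ^ 3) √ε * m)) := by
  set g := min (ε ^ 2) √ε with hg
  have hg0 : 0 ≤ g := le_min (by positivity) (by positivity)
  have hE := mul_le_mul_of_nonneg_right (min_cube_le hε) hm
  rw [← hg] at hE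
  have hgm : 0 ≤ g * m := by positivity
  -- A large exponent absorbs 3 ≤ exp 2 at the cost of half of itself. Otherwise Markov's bound
  -- suffices, as log(1 + ε) ≥ min(1, ε)/2.
  rcases le_total 4 (c * g * m) with h | h
  · have h3 : (3 : ℝ) ≤ Real.exp 2 := by
      have := Real.add_one_le_exp (2 : ℝ); linarith
    have h4 : min 1 ε * g * m ≤ g * m := by
      rw [mul_assoc]; exact mul_le_of_le_one_left hgm (min_le_left _ _)
    calc P ≤ 3 * Real.exp (-(c * g * m)) := h1
      _ ≤ Real.exp 2 * Real.exp (-(c * g * m)) := by gcongr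
      _ = Real.exp (2 + -(c * g * m)) := (Real.exp_add _ _).symm
      _ ≤ _ := by
          rw [Real.exp_le_exp]
          have h5 := mul_le_mul_of_nonneg_left (hE.trans h4) hc.le
          nlinarith
  · refine h2.trans ?_
    rw [one_div, ← Real.exp_log (show 0 < 1 + ε by positivity), ← Real.exp_neg, Real.exp_le_exp]
    have h3 := half_min_le_log hε
    have h4 : 0 ≤ min 1 ε := le_min (by norm_num) hε.le
    have h5 := mul_le_mul_of_nonneg_left h h4
    have h6 := mul_le_mul_of_nonneg_left hE hc.le
    nlinarith

variable {V : Type*} [DecidableEq V]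

/-- A `k`-uniform hypergraph on `U` with codegrees at most `d`. -/
structure IsAlmostLinear (E : Finset (Finset V)) (U : Finset V) (k d : ℕ) : Prop where
  subset : ∀ e ∈ E, e ⊆ U
  card_eq : ∀ e ∈ E, #e = k
  codegree_le : ∀ u v, u ≠ v → #{e ∈ E | u ∈ e ∧ v ∈ e} ≤ d

variable {E : Finset (Finset V)} {U : Finset V} {k d : ℕ}

lemma IsAlmostLinear.degree_le (h : IsAlmostLinear E U k d) (hk : 2 ≤ k) (v : V) :
    #{e ∈ E | v ∈ e} ≤ #U * d := by
  have hsub : {e ∈ E | v ∈ e} ⊆ (U.erase v).biUnion fun u => {e ∈ E | u ∈ e ∧ v ∈ e} := by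
    intro e he
    obtain ⟨heE, hve⟩ := mem_filter.1 he
    have : (e.erase v).Nonempty := by
      rw [← card_pos, card_erase_of_mem hve, h.card_eq e heE]
      omega
    obtain ⟨u, hu⟩ := this
    obtain ⟨huv, hue⟩ := mem_erase.1 hu
    exact mem_biUnion.2 ⟨u, mem_erase.2 ⟨huv, h.subset e heE hue⟩, mem_filter.2 ⟨heE, hue, hve⟩⟩
  exact (card_le_card hsub).trans ((card_biUnion_le_card_mul _ _ d fun u hu =>
    h.codegree_le u v (mem_erase.1 hu).1).trans (Nat.mul_le_mul_right _ card_erase_le))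

variable [Fintype V] {w : Finset V → ℝ} {p : ℝ}

lemma IsAlmostLinear.pr_le_markov (h : IsAlmostLinear E U k d) (hw : IsBernoulliWeight w U p)
    (hμ0 : 0 < #E * p ^ k) {ε : ℝ} (hε : 0 < ε) :
    pr w {S | (1 + ε) * (#E * p ^ k) ≤ (#(within E S) : ℝ)} ≤ 1 / (1 + ε) := by
  have h1 := hw.mul_pr_le (f := fun S => (#(within E S) : ℝ)) (fun S => Nat.cast_nonneg _)
    ((1 + ε) * (#E * p ^ k))
  rw [hw.sum_mul_card_within h.subset, sum_congr rfl fun e he => by rw [h.card_eq e he],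
    sum_const, nsmul_eq_mul] at h1
  rw [le_div_iff₀ (by positivity)]
  refine le_of_mul_le_mul_left ?_ hμ0
  linarith

omit [Fintype V] in
lemma IsAlmostLinear.sum_pow (h : IsAlmostLinear E U k d) (p : ℝ) :
    ∑ e ∈ E, p ^ #e = #E * p ^ k := by
  rw [sum_congr rfl fun e he => by rw [h.card_eq e he], sum_const, nsmul_eq_mul]

/-- The upper tail bound for small `p`. -/
lemma IsAlmostLinear.pr_le_sparse (h : IsAlmostLinear E U k d) (hk : 3 ≤ k) (hd : 0 < d)
    {a D n : ℝ} (ha : 0 < a) (hD : 1 ≤ D) (hdD : d ≤ D) (hn : 0 < n) (hU : #U ≤ D * n)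
    (hE : a * n ^ 2 ≤ #E) {z : ℝ} (hz : 0 < z) (hz1 : z ≤ 1 / 2) (hz2 : 27 * D ^ 2 * z ≤ √a)
    (hw : IsBernoulliWeight w U (z ^ 8)) {ε : ℝ} (hε : 0 < ε) {μ : ℝ}
    (hμ : μ = #E * (z ^ 8) ^ k) :
    pr w {S | (1 + ε) * μ ≤ (#(within E S) : ℝ)} ≤
      3 * Real.exp (-(1 / (64 * k ^ 2 * d * (8 * k + 4)) * min (ε ^ 2) √ε *
        min μ (√μ * (1 + Real.log (1 / z ^ 8))))) := by
  have hE0 : (0 : ℝ) < #E := lt_of_lt_of_le (by positivity) hE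
  have hμ0 : 0 < μ := by rw [hμ]; positivity
  have hp1 : z ^ 8 ≤ 1 := pow_le_one₀ hz.le (by linarith)
  have hkpos : (0 : ℝ) < k := by exact_mod_cast (show 0 < k by omega)
  have hk1 : (1 : ℝ) ≤ k := by exact_mod_cast (show 1 ≤ k by omega)
  have hdpos : (0 : ℝ) < d := by exact_mod_cast hd
  have hd1 : (1 : ℝ) ≤ d := by exact_mod_cast hd
  set ℓ := Real.log (1 / z ^ 8) with hℓ
  have hℓz : ℓ = 8 * -Real.log z := by
    rw [hℓ, one_div, Real.log_inv, Real.log_pow]; norm_num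
  have hℓ1 : 1 ≤ ℓ := by
    have h1 : Real.log z ≤ Real.log (1 / 2) := Real.log_le_log hz hz1
    rw [one_div, Real.log_inv] at h1
    have := Real.log_two_gt_d9
    linarith
  set L := 1 + ℓ with hL
  have hL0 : 0 < L := by linarith
  set x := (1 + ε) * μ with hx
  set t := ε * μ with ht
  have ht0 : 0 < t := by positivity
  -- The smallest size satisfying both requirements of `star_bound`.
  set M := max (8 * k + 4 : ℝ) (√x / L) with hM
  have hM1 : 1 ≤ M := le_trans (by linarith) (le_max_left _ _)
  set s := ⌈M⌉₊ with hs
  have hMs : M ≤ s := Nat.le_ceil M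
  have hsM : (s : ℝ) ≤ 2 * M := by
    have := Nat.ceil_lt_add_one (show 0 ≤ M by linarith)
    linarith
  have hs0 : 0 < s := Nat.ceil_pos.2 (by linarith)
  have hs0' : (0 : ℝ) < s := by exact_mod_cast hs0
  have hsk : 8 * k + 4 ≤ s := by
    have := (le_max_left (8 * k + 4 : ℝ) (√x / L)).trans hMs
    exact_mod_cast this
  have hsx : √x ≤ s * L := by
    have := (le_max_right (8 * k + 4 : ℝ) (√x / L)).trans hMs
    rwa [div_le_iff₀ hL0] at this
  -- Chosen so that (r + 1)s ≤ τ bounds the deleted edges by τ²k²d = t/(4d) ≤ t/2.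
  set τ := √t / (2 * k * d) with hτ
  have hτ0 : 0 < τ := by positivity
  obtain ⟨r, hr1, hr2⟩ := exists_succ_mul_le hs0' hτ0.le
  have hrt : ((r * (s * k) * ((r + 1) * s * (k * d)) : ℕ) : ℝ) ≤ t / 2 := by
    rcases hr1 with rfl | hr1
    · simp; positivity
    · push_cast at hr1 ⊢
      calc (r : ℝ) * (s * k) * ((r + 1) * s * (k * d))
          ≤ (r + 1) * (s * k) * ((r + 1) * s * (k * d)) := by gcongr; linarith
        _ = ((r + 1) * s) ^ 2 * (k ^ 2 * d) := by ring
        _ ≤ τ ^ 2 * (k ^ 2 * d) := by gcongr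
        _ = t / (4 * d) := by
            rw [hτ, div_pow, Real.sq_sqrt ht0.le]
            field_simp
            norm_num
        _ ≤ t / 2 := by gcongr; linarith
  have hΔ := h.degree_le (show 2 ≤ k by omega)
  have hΔD : ((#U * d : ℕ) : ℝ) ≤ D ^ 2 * n := by
    push_cast
    calc (#U : ℝ) * d ≤ (D * n) * D := by gcongr
      _ = D ^ 2 * n := by ring
  have hxμ : a * n ^ 2 * (z ^ 8) ^ k ≤ x := by
    calc a * n ^ 2 * (z ^ 8) ^ k ≤ #E * (z ^ 8) ^ k := by gcongr
      _ = μ := hμ.symm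
      _ ≤ x := by rw [hx]; nlinarith
  have hstar : ∀ j, s ≤ j →
      (#U : ℝ) * ((#U * d).choose j : ℕ) * (z ^ 8) ^ ((k - 1) * j) ≤ z ^ j := fun j hj =>
    star_bound hk ha hD hn hU hΔD hxμ hz hz1 hz2 (hsk.trans hj)
      (hsx.trans (by gcongr))
  have hmain := hw.pr_le_of_stars (by positivity) hp1 h.subset (h.sum_pow (z ^ 8))
    (by rw [← hμ]; exact hμ0) ht0 (show 2 ≤ k by omega) hd hs0 h.card_eq h.codegree_le hΔ hrt
  rw [← hμ] at hmain
  have hxt : x = μ + t := by rw [hx, ht]; ring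
  rw [hxt]
  refine hmain.trans ?_
  set m := min μ (√μ * L) with hm
  have hm0 : 0 ≤ m := le_min hμ0.le (by positivity)
  set g := min (ε ^ 2) √ε with hg
  have hg0 : 0 ≤ g := le_min (by positivity) (by positivity)
  set c : ℝ := 1 / (64 * k ^ 2 * d * (8 * k + 4)) with hc
  have hfirst : Real.exp (-(t / (4 * (k * (s * (k * d)) : ℕ)) * Real.log (1 + t / (4 * μ)))) ≤
      Real.exp (-(c * g * m)) := by
    rw [Real.exp_le_exp, neg_le_neg_iff]
    have e1 : t / (4 * μ) = ε / 4 := by rw [ht]; field_simp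
    rw [e1]
    push_cast
    exact tail_exponent_le hε hμ0 hL0 hkpos hdpos (by positivity) hsM
  -- Both star events, r + 1 disjoint stars of size s and one star of size (r + 1)s, are bounded by
  -- this same power.
  have hsecond : z ^ ((r + 1) * s) ≤ Real.exp (-(c * g * m)) := by
    rw [← Real.exp_log hz, ← Real.exp_nat_mul, Real.exp_le_exp]
    have e1 : Real.log z = -(ℓ / 8) := by linarith
    rw [e1, mul_neg, neg_le_neg_iff]
    refine (star_exponent_le hε hμ0 hL0 hk1 hdpos).trans ?_
    rw [← ht, ← hτ]
    push_cast at hr2 ⊢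
    calc τ / 2 * (L / 16) ≤ (r + 1) * s * (ℓ / 8) :=
          mul_le_mul hr2 (by linarith) (by positivity) (by positivity)
      _ = _ := by ring
  have h1 := pow_le_pow_left₀ (by positivity) (hstar s le_rfl) (r + 1)
  rw [← pow_mul z s, mul_comm s (r + 1)] at h1
  have h2 := hstar ((r + 1) * s) (Nat.le_mul_of_pos_left s (by omega))
  linarith

/-- The upper tail bound for `p` bounded away from `0`. -/
lemma IsAlmostLinear.pr_le_dense (h : IsAlmostLinear E U k d) (hk : 3 ≤ k) (hd : 0 < d)
    {a D n : ℝ} (ha : 0 < a) (hD : 1 ≤ D) (hdD : d ≤ D) (hn : 0 < n) (hU : #U ≤ D * n)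
    (hE : a * n ^ 2 ≤ #E) {p₀ : ℝ} (hp₀ : 0 < p₀) (hp : p₀ ≤ p) (hp1 : p ≤ 1)
    (hw : IsBernoulliWeight w U p) {ε : ℝ} (hε : 0 < ε) {μ : ℝ} (hμ : μ = #E * p ^ k) :
    pr w {S | (1 + ε) * μ ≤ (#(within E S) : ℝ)} ≤
      Real.exp (-(√a * p₀ ^ k / (32 * k * D ^ 2 * (1 + Real.log (1 / p₀))) * min (ε ^ 3) √ε *
        min μ (√μ * (1 + Real.log (1 / p))))) := by
  have hp0 : 0 < p := hp₀.trans_le hp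
  have hE0 : (0 : ℝ) < #E := lt_of_lt_of_le (by positivity) hE
  have hμ0 : 0 < μ := by rw [hμ]; positivity
  have hkpos : (0 : ℝ) < k := by exact_mod_cast (show 0 < k by omega)
  have hU0 : 0 < #U := by
    obtain ⟨e, he⟩ := card_pos.1 (show 0 < #E by exact_mod_cast hE0)
    have := card_le_card (h.subset e he)
    rw [h.card_eq e he] at this
    omega
  have hU0' : (0 : ℝ) < #U := by exact_mod_cast hU0
  have hd0' : (0 : ℝ) < d := by exact_mod_cast hd
  have hmain := hw.pr_le_of_degree_le hp0.le h.subset (h.sum_pow p)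
    (by rw [← hμ]; exact hμ0) (show 0 < ε * μ by positivity) (show 0 < k by omega)
    (Nat.mul_pos hU0 hd) h.card_eq (h.degree_le (by omega))
  rw [← hμ, show ε * μ / (4 * μ) = ε / 4 by field_simp,
    show μ + ε * μ = (1 + ε) * μ by ring] at hmain
  refine hmain.trans ?_
  rw [Real.exp_le_exp, neg_le_neg_iff]
  have hl0 : 0 ≤ Real.log (1 / p₀) :=
    Real.log_nonneg ((one_le_div hp₀).2 (hp.trans hp1))
  have hlp : 0 ≤ Real.log (1 / p) := Real.log_nonneg ((one_le_div hp0).2 hp1)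
  have hll : Real.log (1 / p) ≤ Real.log (1 / p₀) :=
    Real.log_le_log (by positivity) (one_div_le_one_div_of_le hp₀ hp)
  set L := 1 + Real.log (1 / p) with hL
  set L₀ := 1 + Real.log (1 / p₀) with hL₀
  have hLpos : 0 < L := by linarith
  have hL₀pos : 0 < L₀ := by linarith
  have hLL : L ≤ L₀ := by linarith
  -- The maximum degree, of order n, is thus O(√μ), so the exponent t/Δ has order at least √μ.
  have hnμ : √a * n * p₀ ^ k ≤ √μ := by
    refine Real.le_sqrt_of_sq_le ?_
    have hpk : (p₀ ^ k) ^ 2 ≤ p ^ k := by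
      rw [sq]
      calc p₀ ^ k * p₀ ^ k ≤ p ^ k * 1 := by
            gcongr
            exact pow_le_one₀ hp₀.le (hp.trans hp1)
        _ = p ^ k := mul_one _
    calc (√a * n * p₀ ^ k) ^ 2 = a * n ^ 2 * (p₀ ^ k) ^ 2 := by
          rw [mul_pow, mul_pow, Real.sq_sqrt ha.le]
      _ ≤ #E * p ^ k := by gcongr
      _ = μ := hμ.symm
  have hlog := min_le_mul_log hε
  have hlog0 : 0 ≤ Real.log (1 + ε / 4) := Real.log_nonneg (by linarith)
  have hE3 : min (ε ^ 3) √ε / 8 ≤ ε * Real.log (1 + ε / 4) := by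
    have hg0 : 0 ≤ min (ε ^ 2) √ε := le_min (by positivity) (by positivity)
    have h1 : min (ε ^ 3) √ε ≤ min (ε ^ 2) √ε :=
      (min_cube_le hε).trans (mul_le_of_le_one_left hg0 (min_le_left _ _))
    have h2 : 1 ≤ √(1 + ε) := Real.one_le_sqrt.2 (by linarith)
    nlinarith
  have hm0 : 0 ≤ min (ε ^ 3) √ε := le_min (by positivity) (by positivity)
  rw [div_mul_eq_mul_div, div_mul_eq_mul_div, div_mul_eq_mul_div,
    div_le_div_iff₀ (by positivity) (by positivity)]
  push_cast
  calc √a * p₀ ^ k * min (ε ^ 3) √ε * min μ (√μ * L) * (4 * (k * (#U * d)))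
      ≤ √a * p₀ ^ k * min (ε ^ 3) √ε * (√μ * L₀) * (4 * (k * ((D * n) * D))) := by
        gcongr
        exact (min_le_right _ _).trans (by gcongr)
    _ = (√a * n * p₀ ^ k) * (min (ε ^ 3) √ε / 8) * (√μ * (32 * k * D ^ 2 * L₀)) := by ring
    _ ≤ √μ * (ε * Real.log (1 + ε / 4)) * (√μ * (32 * k * D ^ 2 * L₀)) := by gcongr
    _ = ε * (√μ) ^ 2 * Real.log (1 + ε / 4) * (32 * k * D ^ 2 * L₀) := by ring
    _ = ε * μ * Real.log (1 + ε / 4) * (32 * k * D ^ 2 * L₀) := by rw [Real.sq_sqrt hμ0.le]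

end UpperTail

/-! ### The two tail bounds with uniform constants. -/

namespace UpperTail

open Finset

lemma log_exp_one_div {p : ℝ} (hp : 0 < p) :
    Real.log (Real.exp 1 / p) = 1 + Real.log (1 / p) := by
  rw [Real.log_div (Real.exp_pos 1).ne' hp.ne', Real.log_exp, one_div, Real.log_inv]
  ring

lemma exp_neg_mul_le_of_le {b b' x y : ℝ} (hb : b ≤ b') (hx : 0 ≤ x) (hy : 0 ≤ y) :
    Real.exp (-(b' * x * y)) ≤ Real.exp (-(b * x * y)) := by
  rw [Real.exp_le_exp, neg_le_neg_iff]
  gcongr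

theorem IsAlmostLinear.exists_upper_bound {k d : ℕ} (hk : 3 ≤ k) (hd : 0 < d) {a D : ℝ}
    (ha : 0 < a) (hD : 1 ≤ D) (hdD : d ≤ D) :
    ∃ b : ℝ, 0 < b ∧ ∀ (V : Type*) [Fintype V] [DecidableEq V] (E : Finset (Finset V))
      (U : Finset V) (w : Finset V → ℝ) (p n ε μ : ℝ), IsAlmostLinear E U k d → 0 < n →
      #U ≤ D * n → a * n ^ 2 ≤ #E → 0 < p → p ≤ 1 → IsBernoulliWeight w U p → 0 < ε →
      μ = #E * p ^ k →
      pr w {S | (1 + ε) * μ ≤ (#(within E S) : ℝ)} ≤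
        Real.exp (-(b * min (ε ^ 3) √ε * min μ (√μ * Real.log (Real.exp 1 / p)))) := by
  have hsa : 0 < √a := Real.sqrt_pos.2 ha
  have hkpos : (0 : ℝ) < k := by exact_mod_cast (show 0 < k by omega)
  have hdpos : (0 : ℝ) < d := by exact_mod_cast hd
  set z₀ : ℝ := min (1 / 2) (√a / (27 * D ^ 2)) with hz₀
  have hz₀0 : 0 < z₀ := lt_min (by norm_num) (by positivity)
  have hz₀1 : z₀ ≤ 1 / 2 := min_le_left _ _
  have hp₀1 : z₀ ^ 8 ≤ 1 := pow_le_one₀ hz₀0.le (by linarith)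
  have hL₀ : 0 ≤ Real.log (1 / z₀ ^ 8) :=
    Real.log_nonneg ((one_le_div (by positivity)).2 hp₀1)
  set b₁ : ℝ := 1 / (64 * k ^ 2 * d * (8 * k + 4)) with hb₁
  set b₂ : ℝ := √a * (z₀ ^ 8) ^ k / (32 * k * D ^ 2 * (1 + Real.log (1 / z₀ ^ 8))) with hb₂
  have hb₁0 : 0 < b₁ := by positivity
  have hb₂0 : 0 < b₂ := by positivity
  refine ⟨min (b₁ / 8) b₂, by positivity, ?_⟩
  intro V _ _ E U w p n ε μ h hn hU hE hp hp1 hw hε hμ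
  have hE0 : (0 : ℝ) < #E := lt_of_lt_of_le (by positivity) hE
  have hμ0 : 0 < #E * p ^ k := by positivity
  rw [log_exp_one_div hp]
  have hlp : 0 ≤ Real.log (1 / p) := Real.log_nonneg ((one_le_div hp).2 hp1)
  have hm0 : 0 ≤ min μ (√μ * (1 + Real.log (1 / p))) :=
    le_min (hμ ▸ hμ0.le) (by positivity)
  have hg0 : 0 ≤ min (ε ^ 3) √ε := le_min (by positivity) (by positivity)
  rcases le_total p (z₀ ^ 8) with hpz | hpz
  · refine le_trans ?_ (exp_neg_mul_le_of_le (min_le_left _ _) hg0 hm0)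
    obtain ⟨z, hz, rfl⟩ : ∃ z : ℝ, 0 < z ∧ z ^ 8 = p :=
      ⟨p ^ (1 / 8 : ℝ), by positivity, by
        rw [← Real.rpow_natCast, ← Real.rpow_mul hp.le]; norm_num⟩
    have hzz : z ≤ z₀ := le_of_pow_le_pow_left₀ (by norm_num) hz₀0.le hpz
    have hz2 : 27 * D ^ 2 * z ≤ √a := by
      have := hzz.trans (min_le_right _ _)
      rwa [le_div_iff₀ (by positivity), mul_comm] at this
    refine le_exp_of_le_three_mul hb₁0 hε hm0
      (h.pr_le_sparse hk hd ha hD hdD hn hU hE hz (hzz.trans hz₀1) hz2 hw hε hμ) ?_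
    rw [hμ]
    exact h.pr_le_markov hw hμ0 hε
  · exact le_trans (h.pr_le_dense hk hd ha hD hdD hn hU hE (by positivity) hpz hp1 hw hε hμ)
      (exp_neg_mul_le_of_le (min_le_right _ _) hg0 hm0)

lemma one_add_sq_le {ε : ℝ} (hε : 0 < ε) : (1 + ε) ^ 2 ≤ 4 * max 1 (ε ^ 2) := by
  rcases le_total ε 1 with h | h
  · nlinarith [le_max_left 1 (ε ^ 2)]
  · nlinarith [le_max_right 1 (ε ^ 2)]

/-- In the Poisson regime √μ ≤ log(1/p), so n p^(k/2) = O(log(1/p)). For k ≥ 3 one has p^(k-1) ≤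
p^(k/2) √p, and √p log(1/p) ≤ 2. -/
lemma degree_mul_pow_le {k : ℕ} (hk : 3 ≤ k) {a D n p e Δ : ℝ} (ha : 0 < a) (hn : 0 < n)
    (hp : 0 < p) (hp1 : p ≤ 1) (hΔ : Δ ≤ D ^ 2 * n) (he : a * n ^ 2 ≤ e)
    (hμ : √(e * p ^ k) ≤ Real.log (1 / p)) : Δ * p ^ (k - 1) ≤ 2 * D ^ 2 / √a := by
  have hsa : 0 < √a := Real.sqrt_pos.2 ha
  obtain ⟨y, hy0, rfl⟩ : ∃ y : ℝ, 0 < y ∧ y ^ 2 = p := ⟨√p, Real.sqrt_pos.2 hp, Real.sq_sqrt hp.le⟩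
  have hy1 : y ≤ 1 := by nlinarith
  have h1 : √a * n * y ^ k ≤ √(e * (y ^ 2) ^ k) := by
    refine Real.le_sqrt_of_sq_le ?_
    calc (√a * n * y ^ k) ^ 2 = a * n ^ 2 * (y ^ 2) ^ k := by
          rw [mul_pow, mul_pow, Real.sq_sqrt ha.le]; ring
      _ ≤ e * (y ^ 2) ^ k := by gcongr
  have h2 : Real.log (1 / y ^ 2) * y ≤ 2 := by
    rw [← one_div_pow, Real.log_pow]
    have h3 := Real.log_le_sub_one_of_pos (show 0 < 1 / y by positivity)
    have h4 : 1 / y * y = 1 := by field_simp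
    push_cast
    nlinarith
  have h3 : (y ^ 2) ^ (k - 1) ≤ y ^ k * y := by
    rw [← pow_mul, ← pow_succ]
    exact pow_le_pow_of_le_one hy0.le hy1 (by omega)
  rw [le_div_iff₀ hsa]
  calc Δ * (y ^ 2) ^ (k - 1) * √a ≤ (D ^ 2 * n) * (y ^ 2) ^ (k - 1) * √a := by gcongr
    _ ≤ (D ^ 2 * n) * (y ^ k * y) * √a := by gcongr
    _ = D ^ 2 * ((√a * n * y ^ k) * y) := by ring
    _ ≤ D ^ 2 * (Real.log (1 / y ^ 2) * y) :=
        mul_le_mul_of_nonneg_left (mul_le_mul_of_nonneg_right (h1.trans hμ) hy0.le) (sq_nonneg D)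
    _ ≤ D ^ 2 * 2 := by gcongr
    _ = 2 * D ^ 2 := by ring

theorem IsAlmostLinear.exists_lower_bound {k d : ℕ} (hk : 3 ≤ k) {a D : ℝ}
    (ha : 0 < a) (hD : 1 ≤ D) (hdD : d ≤ D) :
    ∃ B : ℝ, 0 < B ∧ ∀ (V : Type*) [Fintype V] [DecidableEq V] (E : Finset (Finset V))
      (U : Finset V) (w : Finset V → ℝ) (p n ε μ : ℝ) (W : Finset V), IsAlmostLinear E U k d →
      0 < n → #U ≤ D * n → a * n ^ 2 ≤ #E → 0 < p → p ≤ 1 → IsBernoulliWeight w U p → 0 < ε →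
      μ = #E * p ^ k → W ⊆ U → #W ≤ D * max √((1 + ε) * μ) 1 →
      (1 + ε) * μ ≤ #(within E W) → 1 ≤ (1 + ε) * μ →
      Real.exp (-(B * max 1 (ε ^ 2) * min μ (√μ * Real.log (1 / p)))) ≤
        pr w {S | (1 + ε) * μ ≤ (#(within E S) : ℝ)} := by
  have hsa : 0 < √a := Real.sqrt_pos.2 ha
  set c : ℝ := 2 * D ^ 2 / √a with hc
  set K : ℝ := 1 + k * c + k * k * d with hK
  have hc0 : 0 < c := by positivity
  have hK0 : 0 < K := by positivity
  refine ⟨max (2 * D) (32 * K), by positivity, ?_⟩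
  intro V _ _ E U w p n ε μ W h hn hU hE hp hp1 hw hε hμ hWU hW hWx hx1
  have hE0 : (0 : ℝ) < #E := lt_of_lt_of_le (by positivity) hE
  have hμ0 : 0 < μ := by rw [hμ]; positivity
  have hl0 : 0 ≤ Real.log (1 / p) := Real.log_nonneg ((one_le_div hp).2 hp1)
  have hmax0 : 0 ≤ max 1 (ε ^ 2) := by positivity
  set x := (1 + ε) * μ with hx
  rcases le_total (√μ * Real.log (1 / p)) μ with hcase | hcase
  · rw [min_eq_right hcase]
    refine (exp_neg_mul_le_of_le (le_max_left _ _) hmax0 (by positivity)).trans ?_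
    have h1 : pr w {S | W ⊆ S} ≤ pr w {S | x ≤ (#(within E S) : ℝ)} :=
      hw.pr_mono fun S hS => hWx.trans (Nat.cast_le.2 (card_le_card (within_mono E hS)))
    rw [hw.pr_superset W hWU] at h1
    refine le_trans ?_ h1
    have h2 : p ^ #W = Real.exp (-(#W * Real.log (1 / p))) := by
      rw [one_div, Real.log_inv, mul_neg, neg_neg, Real.exp_nat_mul, Real.exp_log hp]
    rw [h2, Real.exp_le_exp, neg_le_neg_iff]
    rw [max_eq_left (Real.one_le_sqrt.2 hx1), hx, Real.sqrt_mul (by positivity)] at hW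
    have h3 : √(1 + ε) ≤ 2 * max 1 (ε ^ 2) := by
      refine Real.sqrt_le_iff.2 ⟨by positivity, ?_⟩
      have h4 := one_add_sq_le hε
      have h5 := le_max_left 1 (ε ^ 2)
      nlinarith
    calc #W * Real.log (1 / p) ≤ D * (√(1 + ε) * √μ) * Real.log (1 / p) := by gcongr
      _ ≤ D * ((2 * max 1 (ε ^ 2)) * √μ) * Real.log (1 / p) := by gcongr
      _ = 2 * D * max 1 (ε ^ 2) * (√μ * Real.log (1 / p)) := by ring
  · rw [min_eq_left hcase]
    refine (exp_neg_mul_le_of_le (le_max_right _ _) hmax0 hμ0.le).trans ?_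
    have hsμ : √μ ≤ Real.log (1 / p) := by
      refine le_of_mul_le_mul_left ?_ (Real.sqrt_pos.2 hμ0)
      rwa [Real.mul_self_sqrt hμ0.le]
    have hΔ := h.degree_le (show 2 ≤ k by omega)
    have hdeg : ((#U * d : ℕ) : ℝ) * p ^ (k - 1) ≤ c := by
      have hd0 : (0 : ℝ) ≤ d := Nat.cast_nonneg d
      have hUd : (#U : ℝ) * d ≤ D ^ 2 * n := by nlinarith
      push_cast
      exact degree_mul_pow_le hk ha hn hp hp1 hUd hE (by rwa [← hμ])
    set m := ⌈x⌉₊ with hm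
    have hxm : x ≤ m := Nat.le_ceil x
    have hmx : (m : ℝ) ≤ 2 * x := by
      have := Nat.ceil_lt_add_one (show 0 ≤ x by linarith)
      linarith
    have hm0 : 0 < m := Nat.ceil_pos.2 (by linarith)
    have hm0' : (0 : ℝ) < m := by exact_mod_cast hm0
    -- The clustering hypothesis is needed here too: it ensures that H has at least (1 + ε)μ edges.
    have hmE : m ≤ #E :=
      (Nat.ceil_le.2 hWx).trans (card_le_card (filter_subset _ _))
    have hlow := hw.pow_le_pr_of_le_card hp hp1 h.subset (show 1 ≤ k by omega) h.card_eq
      h.codegree_le hΔ hdeg hm0 hmE (by rw [← hμ]; nlinarith)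
    rw [← hμ, ← hK] at hlow
    have hsub : pr w {S | m ≤ #(within E S)} ≤ pr w {S | x ≤ (#(within E S) : ℝ)} :=
      hw.pr_mono fun S hS => hxm.trans (Nat.cast_le.2 hS)
    refine le_trans ?_ (hlow.trans hsub)
    -- Each of the m ≤ 2(1 + ε)μ blocks costs a factor 4K(1 + ε). Bounding its logarithm by itself
    -- gives an exponent of order (1 + ε)²μ, hence max(1, ε²).
    have hbase : (4 * K * (1 + ε))⁻¹ ≤ μ / (2 * m * K) := by
      rw [← one_div, div_le_div_iff₀ (by positivity) (by positivity)]
      calc 1 * (2 * m * K) ≤ 1 * (2 * (2 * x) * K) := by gcongr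
        _ = μ * (4 * K * (1 + ε)) := by rw [hx]; ring
    refine le_trans ?_ (pow_le_pow_left₀ (by positivity) hbase m)
    have hpos : 0 < 4 * K * (1 + ε) := by positivity
    rw [← Real.exp_log hpos, ← Real.exp_neg, ← Real.exp_nat_mul, Real.exp_le_exp, mul_neg,
      neg_le_neg_iff]
    have h1 : Real.log (4 * K * (1 + ε)) ≤ 4 * K * (1 + ε) := by
      have := Real.log_le_sub_one_of_pos hpos
      linarith
    have h2 := one_add_sq_le hε
    calc m * Real.log (4 * K * (1 + ε)) ≤ m * (4 * K * (1 + ε)) := by gcongr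
      _ ≤ 2 * x * (4 * K * (1 + ε)) := by gcongr
      _ = 8 * K * (1 + ε) ^ 2 * μ := by rw [hx]; ring
      _ ≤ 8 * K * (4 * max 1 (ε ^ 2)) * μ := by gcongr
      _ = 32 * K * max 1 (ε ^ 2) * μ := by ring

/-! ### From the product measure to weights on finite sets. -/

section Bridge

variable {V : Type*} [Fintype V]

lemma sum_setBernoulli_real_singleton (u : Set V) (p : unitInterval) (A : Set (Set V)) :
    pr (fun S : Finset V => (setBernoulli u p).real {(S : Set V)}) {S | (S : Set V) ∈ A} =
      (setBernoulli u p).real A := by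
  classical
  have h1 := integral_fintype (μ := setBernoulli u p) (f := A.indicator (1 : Set V → ℝ))
    (Integrable.of_finite)
  rw [integral_indicator_one (MeasurableSet.of_discrete)] at h1
  rw [h1, pr, ← Equiv.sum_comp (Fintype.finsetEquivSet (α := V))]
  refine sum_congr rfl fun S _ => ?_
  by_cases h : (S : Set V) ∈ A <;> simp [h]

omit [Fintype V] in
lemma setBernoulli_real_superset (u : Set V) (p : unitInterval) (A : Finset V)
    (hA : (A : Set V) ⊆ u) :
    (setBernoulli u p).real {T | (A : Set V) ⊆ T} = (p : ℝ) ^ #A := by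
  classical
  have key : (fun q : V → Prop => {i | q i}) ⁻¹' {T : Set V | (A : Set V) ⊆ T} =
      Set.pi (A : Set V) fun _ => {True} := by
    ext q
    simp [Set.pi, Set.subset_def]
  rw [measureReal_def, setBernoulli_apply', key, Measure.infinitePi_pi]
  · rw [prod_congr rfl fun i hi => ?_, prod_const]
    rotate_left
    · exact (unitInterval.toNNReal p : ENNReal)
    · have : i ∈ u := hA hi
      simp [this]
    · simp
  · exact fun _ _ => MeasurableSet.of_discrete

lemma isBernoulliWeight_setBernoulli [DecidableEq V] (U : Finset V) (p : unitInterval) :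
    IsBernoulliWeight (fun S : Finset V => (setBernoulli (U : Set V) p).real {(S : Set V)}) U p where
  nonneg S := measureReal_nonneg
  pr_superset A hA := by
    rw [← setBernoulli_real_superset (U : Set V) p A (by exact_mod_cast hA),
      ← sum_setBernoulli_real_singleton]
    simp
  supermodular S T := by
    -- Within U, equality holds because cardinality is modular; otherwise the left side vanishes.
    by_cases hS : S ⊆ U
    · by_cases hT : T ⊆ U
      · have key (R : Finset V) (hR : R ⊆ U) :
            (setBernoulli (U : Set V) p).real {(R : Set V)} =
              (p : ℝ) ^ #R * (1 - p : ℝ) ^ (#U - #R) := by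
          rw [setBernoulli_real_singleton p (by exact_mod_cast hR) U.finite_toSet,
            ← coe_sdiff, Set.ncard_coe_finset, Set.ncard_coe_finset, card_sdiff_of_subset hR]
        have hI : S ⊓ T ⊆ U := inter_subset_left.trans hS
        have hU : S ⊔ T ⊆ U := union_subset hS hT
        rw [key S hS, key T hT, key _ hI, key _ hU]
        have h1 := card_union_add_card_inter S T
        have h2 := card_le_card hS
        have h3 := card_le_card hT
        have h4 := card_le_card hI
        have h5 := card_le_card hU
        rw [inf_eq_inter, sup_eq_union] at *
        rw [mul_mul_mul_comm, mul_mul_mul_comm _ _ ((p : ℝ) ^ _), ← pow_add, ← pow_add, ← pow_add,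
          ← pow_add]
        refine le_of_eq ?_
        congr 2 <;> omega
      · have : (setBernoulli (U : Set V) p).real {(T : Set V)} = 0 := by
          rw [measureReal_def, setBernoulli_singleton_of_not_subset p (by exact_mod_cast hT)]
          rfl
        simp only [this, mul_zero]
        positivity
    · have : (setBernoulli (U : Set V) p).real {(S : Set V)} = 0 := by
        rw [measureReal_def, setBernoulli_singleton_of_not_subset p (by exact_mod_cast hS)]
        rfl
      simp only [this, zero_mul]
      positivity

end Bridge

end UpperTail

/-! ### Translation of the hypergraph definitions, and the theorem. -/

namespace UpperTail

open Finset

variable {V : Type*} [Fintype V]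

open Classical in
/-- The edges of a hypergraph on a finite type, as finite sets. -/
noncomputable def edges (H : Hypergraph V) : Finset (Finset V) := {e | (e : Set V) ∈ H.edgeSet}

lemma mem_edges {H : Hypergraph V} {e : Finset V} : e ∈ edges H ↔ (e : Set V) ∈ H.edgeSet := by
  classical
  simp [edges]

lemma ncard_eq_card_of_forall_mem_iff {Q : Set (Set V)} {F : Finset (Finset V)}
    (h : ∀ e : Finset V, e ∈ F ↔ (e : Set V) ∈ Q) : Q.ncard = #F := by
  classical
  have : Q = (fun e : Finset V => (e : Set V)) '' (F : Set (Finset V)) := by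
    ext T
    simp only [Set.mem_image, Finset.mem_coe]
    constructor
    · intro hT
      exact ⟨T.toFinset, by rw [h]; simpa using hT, by simp⟩
    · rintro ⟨e, he, rfl⟩
      exact (h e).1 he
  rw [this, Set.ncard_image_of_injective _ coe_injective, Set.ncard_coe_finset]

lemma numEdges_eq (H : Hypergraph V) : H.numEdges = #(edges H) :=
  ncard_eq_card_of_forall_mem_iff fun _ => mem_edges

variable [DecidableEq V]

lemma inducedEdgeCount_coe (H : Hypergraph V) (S : Finset V) :
    H.inducedEdgeCount (S : Set V) = #(within (edges H) S) := by
  unfold Hypergraph.inducedEdgeCount Hypergraph.numEdges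
  congr 1
  refine ncard_eq_card_of_forall_mem_iff fun e => ?_
  rw [mem_within, mem_edges]
  simp [Hypergraph.induced]

lemma upperTail_eq (H : Hypergraph V) (p : unitInterval) (x : ℝ) :
    H.upperTail p x = pr (fun S : Finset V => (H.randomVertexSet p).real {(S : Set V)})
      {S | x ≤ (#(within (edges H) S) : ℝ)} := by
  rw [Hypergraph.upperTail, Hypergraph.randomVertexSet, ← sum_setBernoulli_real_singleton]
  simp [inducedEdgeCount_coe]

omit [DecidableEq V] in
lemma exists_coe_eq_vertexSet (H : Hypergraph V) : ∃ U : Finset V, (U : Set V) = H.vertexSet := by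
  classical
  exact ⟨H.vertexSet.toFinset, by simp⟩

lemma isBernoulliWeight_randomVertexSet {H : Hypergraph V} {U : Finset V}
    (hU : (U : Set V) = H.vertexSet) (p : unitInterval) :
    IsBernoulliWeight (fun S : Finset V => (H.randomVertexSet p).real {(S : Set V)}) U p := by
  rw [Hypergraph.randomVertexSet, ← hU]
  exact isBernoulliWeight_setBernoulli U p

lemma isAlmostLinear_edges {H : Hypergraph V} {U : Finset V} (hU : (U : Set V) = H.vertexSet)
    {k d : ℕ} (hk : H.IsUniform k) (hd : H.maxDegree 2 ≤ d) :
    IsAlmostLinear (edges H) U k d where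
  subset e he := by
    rw [← Finset.coe_subset, hU]
    exact H.subset_vertexSet_of_mem_edgeSet' (mem_edges.1 he)
  card_eq e he := by
    rw [← Set.ncard_coe_finset]
    exact hk _ (mem_edges.1 he)
  codegree_le u v huv := by
    -- The maximum degree only sees pairs of vertices of H; any other pair lies in no edge.
    by_cases huvH : ({u, v} : Set V) ⊆ H.vertexSet
    · have h1 : {f : Set V | f ∈ H.edgeSet ∧ ({u, v} : Set V) ⊆ f}.ncard =
          #{e ∈ edges H | u ∈ e ∧ v ∈ e} := by
        refine ncard_eq_card_of_forall_mem_iff fun e => ?_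
        rw [mem_filter, mem_edges]
        simp only [Set.mem_ofPred_eq, Set.insert_subset_iff, Set.singleton_subset_iff, mem_coe]
      rw [← h1]
      refine le_trans ?_ hd
      rw [Hypergraph.maxDegree]
      refine le_csSup ⟨(Set.univ : Set (Set V)).ncard, ?_⟩
        ⟨{u, v}, huvH, Set.ncard_pair huv, rfl⟩
      rintro _ ⟨S, -, -, rfl⟩
      exact Set.ncard_le_ncard (Set.subset_univ _)
    · rw [filter_eq_empty_iff.2]
      · simp
      · intro e he hmem
        obtain ⟨hu, hv⟩ := hmem
        refine huvH (Set.Subset.trans ?_ (H.subset_vertexSet_of_mem_edgeSet' (mem_edges.1 he)))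
        simp [Set.insert_subset_iff, hu, hv]

lemma meanEdgeCount_eq {H : Hypergraph V} {k : ℕ} (hk : H.IsUniform k) (p : unitInterval) :
    H.meanEdgeCount p = #(edges H) * (p : ℝ) ^ k := by
  obtain ⟨U, hU⟩ := exists_coe_eq_vertexSet H
  have hlin := isAlmostLinear_edges hU hk le_rfl
  have hw := isBernoulliWeight_randomVertexSet hU p
  rw [← hlin.sum_pow, ← hw.sum_mul_card_within hlin.subset, Hypergraph.meanEdgeCount,
    Hypergraph.randomVertexSet, integral_fintype Integrable.of_finite,
    ← Equiv.sum_comp (Fintype.finsetEquivSet (α := V))]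
  refine sum_congr rfl fun S _ => ?_
  simp [inducedEdgeCount_coe]

end UpperTail


theorem mainTheorem1 (k : ℕ) (hk : 3 ≤ k) (a : ℝ) (ha : 0 < a) (D : ℝ) (hD : 1 ≤ D) :
    ∃ (n₀ : ℕ) (b B : ℝ), 0 < n₀ ∧ 0 < b ∧ 0 < B ∧
      ∀ n : ℕ, n₀ ≤ n →
      ∀ (V : Type*) [Finite V] (H : Hypergraph V),
        H.IsUniform k →
        (H.numVertices : ℝ) ≤ D * (n : ℝ) →
        a * (n : ℝ) ^ 2 ≤ (H.numEdges : ℝ) →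
        (H.maxDegree 2 : ℝ) ≤ D →
      ∀ (p : unitInterval), 0 < (p : ℝ) → ∀ ε : ℝ, 0 < ε →
        H.upperTail p ((1 + ε) * H.meanEdgeCount p) ≤
            Real.exp (-(b * min (ε ^ 3) (Real.sqrt ε) *
              min (H.meanEdgeCount p)
                (Real.sqrt (H.meanEdgeCount p) * Real.log (Real.exp 1 / (p : ℝ))))) ∧
        (H.ClusterProperty D ((1 + ε) * H.meanEdgeCount p) →
          1 ≤ (1 + ε) * H.meanEdgeCount p →
          Real.exp (-(B * max 1 (ε ^ 2) *
              min (H.meanEdgeCount p)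
                (Real.sqrt (H.meanEdgeCount p) * Real.log (1 / (p : ℝ))))) ≤
            H.upperTail p ((1 + ε) * H.meanEdgeCount p)) := by
  -- The integral codegree bound is d = ⌊D⌋, positive since D ≥ 1.
  have hd0 : 0 < ⌊D⌋₊ := Nat.floor_pos.2 hD
  have hdD : (⌊D⌋₊ : ℝ) ≤ D := Nat.floor_le (by linarith)
  obtain ⟨b, hb, hupper⟩ := UpperTail.IsAlmostLinear.exists_upper_bound hk hd0 ha hD hdD
  obtain ⟨B, hB, hlower⟩ := UpperTail.IsAlmostLinear.exists_lower_bound hk ha hD hdD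
  refine ⟨1, b, B, one_pos, hb, hB, ?_⟩
  intro n hn V _ H hunif hv he hd p hp ε hε
  classical
  have := Fintype.ofFinite V
  obtain ⟨U, hU⟩ := UpperTail.exists_coe_eq_vertexSet H
  have hlin := UpperTail.isAlmostLinear_edges hU hunif (Nat.le_floor hd)
  have hw := UpperTail.isBernoulliWeight_randomVertexSet hU p
  have hn0 : (0 : ℝ) < n := by exact_mod_cast hn
  have hμ := UpperTail.meanEdgeCount_eq hunif p
  rw [Hypergraph.numVertices, ← hU, Set.ncard_coe_finset] at hv
  rw [UpperTail.numEdges_eq] at he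
  rw [UpperTail.upperTail_eq]
  refine ⟨hupper V _ U _ p n ε _ hlin hn0 hv he hp p.2.2 hw hε hμ, ?_⟩
  rintro ⟨W, hWH, hWcard, hWx⟩ hx1
  obtain ⟨W, rfl⟩ : ∃ W' : Finset V, (W' : Set V) = W := ⟨W.toFinset, by simp⟩
  rw [← hU, Finset.coe_subset] at hWH
  rw [Set.ncard_coe_finset] at hWcard
  exact hlower V _ U _ p n ε _ W hlin hn0 hv he hp p.2.2 hw hε hμ hWH hWcard
    (hWx.trans_eq (UpperTail.inducedEdgeCount_coe H W)) hx1
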